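/- All operators act on a finite register of qubits. $CX(c,t)$ with $c\ne t$ is the controlled-NOT gate with control $c$ and target $t$. A layer is a set of mutually commuting $CX$ gates, that is, no qubit is both the control of a gate and the target of a gate of the layer. A $CX$ circuit is a finite sequence of layers, and its depth is the number of layers. A circuit with unitary $U$ conjugates $H$ to $UHU^\dagger$. For a finite set $S$ of qubits, $X_S=\prod_{i\in S}X_i$ and $Z_S=\prod_{i\in S}Z_i$. **Toric code.** Let $L\ge 2$, put a qubit on each of the $2L^2$ edges of the $L\times L$ square lattice on the torus, and let $$H_{TC}=-\sum_{v}X_{\mathrm{star}(v)}-\sum_{p}Z_{\partial p},$$ where $v$ runs over the vertices, $p$ over the plaquettes, $\mathrm{star}(v)$ is the set of the four edges at $v$ and $\partial p$ the set of the four edges of $p$. There is a $CX$ circuit $U$ of depth at most $L$, each of whose gates acts on two edges with a common end point, and there are disjoint sets of qubits $q_x,q_z$, such that $$UH_{TC}U^\dagger=H_X+H_Z,\qquad H_X=-\sum_{i\in q_x}X_i-\prod_{i\in q_x}X_i,$$ and $H_Z$ is minus a sum of products of $Z$ operators on $q_z$. The two systems can be identified with 1D Ising loops. Precisely, there are disjoint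 families of pairwise distinct qubits $a_1,\dots,a_{L^2}$ and $b_1,\dots,b_{L^2}$ with $q_x\subseteq\{a_1,\dots,a_{L^2}\}$ and $\{b_1,\dots,b_{L^2}\}\subseteq q_z$, a $CX$ circuit $V_X$ on the qubits $a_i$, and a single layer $V_Z$ of $CX$ gates on the qubits of $q_z$ (both not necessarily local), such that, with indices modulo $L^2$, $$V_XH_XV_X^\dagger=-\sum_{i=1}^{L^2}X_{a_i}X_{a_{i+1}},\qquad V_ZH_ZV_Z^\dagger=-\sum_{i=1}^{L^2}Z_{b_i}Z_{b_{i+1}}.$$ **Rotated surface code.** Let $L\ge 1$ and put a qubit on each of the $(L+1)^2$ lattice points of $[0,L]\times[0,L]$. Colour the unit squares of the plane as a checkerboard with colours $X$ and $Z$, the square $[0,1]\times[0,1]$ having colour $X$, and let $$H_{RSC}=-\sum_{s}X_s-\sum_{s}Z_s.$$ The first sum runs over the $X$-coloured unit squares inside $[0,L]\times[0,L]$ and those attached from outside to an edge on its left or right side. The second sum runs over the $Z$-coloured unit squares inside $[0,L]\times[0,L]$ and those attached from outside to an edge on its bottom or top side. Here $s$ is identified with the set of its corners that carry a qubit (four for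 an inner square, two for an outer one). Call a gate local if it acts on two corners of a common unit square. There is a circuit $U$ of local $CX$ gates, of depth at most $L/2$ if $L$ is even and at most $(L-1)/2+2$ if $L$ is odd, and there are disjoint sets of qubits $q_x,q_z$, such that $$UH_{RSC}U^\dagger=H_X+H_Z,\qquad H_X=-\sum_{i\in q_x}X_i,$$ and $H_Z$ is minus a sum of products of $Z$ operators on $q_z$. So the $X$ system is a uniform magnetic field, that is, a family of one-spin Ising chains. The $Z$ system is identified with open Ising chains by a further (classical) local circuit: there is a circuit $W$ of local $CX$ gates on qubits of $q_z$, of depth at most $\lceil L/2\rceil$, such that $WH_ZW^\dagger$ is the sum, over at most $2L$ pairwise disjoint nonempty chains $(i_1,\dots,i_n)$ of distinct qubits in $q_z$, of the Hamiltonians $$-\sum_{k=1}^{n-1}Z_{i_k}Z_{i_{k+1}}-Z_{i_n}$$ of an Ising chain with a magnetic field at one end. If $L$ is even, there are exactly $L$ chains, each on $L/2+1$ qubits. -/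

import Mathlib

/-! Qubits are the elements of a finite type `Q`. The computational basis of the register consists
of the bit assignments `Q → ZMod 2`, and operators are complex matrices over this basis. -/

namespace CSSIsing

/-- Operators on the register of qubits `Q`. -/
abbrev Op (Q : Type) : Type := Matrix (Q → ZMod 2) (Q → ZMod 2) ℂ

section Operators

variable {Q : Type} [Fintype Q] [DecidableEq Q]

/-- The product of the Pauli `X` operators of the qubits in `S`: it flips the bits in `S`. -/
def pauliX (S : Finset Q) : Op Q :=
  Matrix.of fun s s' => if s = (fun i => if i ∈ S then s' i + 1 else s' i) then 1 else 0

/-- The product of the Pauli `Z` operators of the qubits in `S`. -/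
def pauliZ (S : Finset Q) : Op Q :=
  Matrix.diagonal fun s => ∏ i ∈ S, (-1 : ℂ) ^ (s i).val

/-- The gate `CX` with control `c` and target `t` (for `c ≠ t`). -/
def cx (c t : Q) : Op Q :=
  Matrix.of fun s s' => if s = Function.update s' t (s' t + s' c) then 1 else 0

/-- A layer of `CX` gates (pairs of control and target), each allowed by `near`: distinct,
mutually commuting gates. Gates `cx c t` and `cx c' t'` commute exactly when `c ≠ t'` and `c' ≠ t`,
and `c ≠ t` is needed for `cx c t` to be a gate. -/
def IsLayer (near : Q → Q → Prop) (l : List (Q × Q)) : Prop :=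
  l.Nodup ∧ (∀ g ∈ l, ∀ h ∈ l, g.1 ≠ h.2) ∧ ∀ g ∈ l, near g.1 g.2

/-- A circuit is a list of layers of `CX` gates; its depth is the number of layers. -/
def IsCircuit (near : Q → Q → Prop) (C : List (List (Q × Q))) : Prop :=
  ∀ l ∈ C, IsLayer near l

/-- The unitary of a circuit; the gates at the head of the list are applied first. -/
def circuitOp (C : List (List (Q × Q))) : Op Q :=
  C.flatten.foldl (fun U g => cx g.1 g.2 * U) 1

/-- The conjugate `U H U†` of `H` by the unitary `U` of the circuit `C`. -/
def conj (C : List (List (Q × Q))) (H : Op Q) : Op Q :=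
  circuitOp C * H * (circuitOp C).conjTranspose

/-- `H` is minus a sum of products of Paulis of the one kind `P` (`pauliX` or `pauliZ`), each of
them supported in the set of qubits `q`. -/
def IsPure (P : Finset Q → Op Q) (q : Finset Q) (H : Op Q) : Prop :=
  ∃ T : Multiset (Finset Q), (∀ S ∈ T, S ⊆ q) ∧ H = -(T.map P).sum

/-- The uniform magnetic field on the qubits in `q`. -/
def field (P : Finset Q → Op Q) (q : Finset Q) : Op Q :=
  -∑ i ∈ q, P {i}

/-- The parity check Hamiltonian on the qubits in `q`. -/
def parityCheck (P : Finset Q → Op Q) (q : Finset Q) : Op Q :=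
  -∑ i ∈ q, P {i} - P q

/-- The open 1D Ising chain along a list of qubits, with a magnetic field on its last qubit. -/
def isingChain (P : Finset Q → Op Q) : List Q → Op Q
  | [] => 0
  | [i] => -P {i}
  | i :: j :: l => -P {i, j} + isingChain P (j :: l)

/-- The periodic 1D Ising model along a cyclically ordered family of qubits. -/
def isingLoop (P : Finset Q → Op Q) {n : ℕ} (a : Fin n → Q) : Op Q :=
  -∑ i : Fin n, P {a i, a (finRotate n i)}

end Operators

section Toric

/-- The qubits of the toric code: the edges of the `L × L` square lattice on the torus. The edge
`(x, y, false)` joins the vertices `(x, y)` and `(x + 1, y)`, and `(x, y, true)` joins `(x, y)` and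
`(x, y + 1)`. -/
abbrev TQubit (L : ℕ) : Type := ZMod L × ZMod L × Bool

/-- The edges that meet the vertex `(x, y)`. -/
def vertexStar {L : ℕ} (x y : ZMod L) : Finset (TQubit L) :=
  {(x, y, false), (x - 1, y, false), (x, y, true), (x, y - 1, true)}

/-- The edges of the square with corners `(x, y)`, `(x + 1, y)`, `(x, y + 1)`, `(x + 1, y + 1)`. -/
def plaquette {L : ℕ} (x y : ZMod L) : Finset (TQubit L) :=
  {(x, y, false), (x, y + 1, false), (x, y, true), (x + 1, y, true)}

/-- The toric code Hamiltonian. -/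
def toricH (L : ℕ) [NeZero L] : Op (TQubit L) :=
  -(∑ x : ZMod L, ∑ y : ZMod L, pauliX (vertexStar x y))
    - ∑ x : ZMod L, ∑ y : ZMod L, pauliZ (plaquette x y)

/-- Locality on the torus: the two edges have a common end point. -/
def toricNear {L : ℕ} (e f : TQubit L) : Prop :=
  ∃ x y : ZMod L, e ∈ vertexStar x y ∧ f ∈ vertexStar x y

end Toric

section Rotated

/-- The qubits of the rotated surface code: the lattice points of `[0, L] × [0, L]`. -/
abbrev RQubit (L : ℕ) : Type := Fin (L + 1) × Fin (L + 1)

/-- The lattice points among the corners of the unit square with upper right corner `(a, b)`, for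
`0 ≤ a, b ≤ L + 1`: four points for a square inside the lattice, and two neighbouring points for
a square that is attached to the boundary from outside (one point at the four corners). -/
def cell {L : ℕ} (a b : ℕ) : Finset (RQubit L) :=
  Finset.univ.filter fun p =>
    (p.1.val = a ∨ p.1.val + 1 = a) ∧ (p.2.val = b ∨ p.2.val + 1 = b)

/-- The rotated surface code Hamiltonian. The squares are coloured as a checkerboard, the lower
left square (`a = b = 1`) being of type `X`; the outer squares on the left and right sides are used
for the `X` boundary terms, those on the bottom and top sides for the `Z` boundary terms. -/
def rotatedH (L : ℕ) : Op (RQubit L) :=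
  -(∑ a ∈ Finset.range (L + 2), ∑ b ∈ Finset.Icc 1 L,
      if Even (a + b) then pauliX (cell a b) else 0)
    - ∑ a ∈ Finset.Icc 1 L, ∑ b ∈ Finset.range (L + 2),
      if Odd (a + b) then pauliZ (cell a b) else 0

/-- Locality on the square lattice: both coordinates differ by at most one, that is, the points
are corners of a common unit square. -/
def rotatedNear {L : ℕ} (p q : RQubit L) : Prop :=
  p.1.val ≤ q.1.val + 1 ∧ q.1.val ≤ p.1.val + 1 ∧
    p.2.val ≤ q.2.val + 1 ∧ q.2.val ≤ p.2.val + 1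

end Rotated

end CSSIsing

/-!
A gate `cx c t` adds the bit of `c` to the bit of `t`. Conjugation by it acts in the same way on the
support, written as a vector over `ZMod 2`, of a product of Pauli `X` operators, and on the support
of a product of Pauli `Z` operators it acts with `c` and `t` exchanged. Everything is thus linear
algebra over `ZMod 2`.

All the circuits below are of one form. Each qubit `q` has a finite set of parents of smaller rank,
and the layer `k` adds to each qubit of rank `k` the bits of its parents. The parents have reached
their final value by then, so the circuit maps `v` to `w` whenever `v q = w q + ∑ t ∈ par q, w t`
for all `q` (`conj_rankCircuit_xVec`, `conj_reverseGates_zVec`). On supports of the opposite kind it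
acts by the transpose of `w ↦ v` (`conj_rankCircuit_zVec`).

For the decoupling circuit, each `X` term is assigned a qubit of its support. When qubits are read
as edges that join the `X` terms containing them, the assigned qubits form a forest: each of them
leads from its `X` term to one that is closer to a root or to the boundary. The parents of `q` are
the other assigned qubits of the `X` terms that contain `q`. Then each `X` term becomes the `X`
operator of its assigned qubit, and each `Z` term loses its assigned qubits, because it meets every
`X` term in an even number of qubits (`exists_forest_circuit`). The depth is that of the forest.

For the toric code the forest is a comb-shaped spanning tree of depth `2 * (L / 2)`, and the star of
the root, as the product of all others, becomes the global term of the parity check. In the dual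
lattice the edges outside the tree form a path of plaquettes in each row, one edge between any two
consecutive rows, and one further edge; adding path segments to the latter edges turns them into a
Hamiltonian cycle, in a single layer (`exists_plaquette_loop_layer`). The parity check is turned
into a loop by telescoping (`exists_parityCheck_loop_circuit`).

For the rotated surface code the forest grows from the bottom and the top towards the row
`y = L / 2`, and away from this row it consists of the even columns (for odd `L` together with every
other point of the last column). What remains of the `Z` terms are chains along the odd columns, for
odd `L` also single points of the last column, and the `L` links of the path formed by the middle
row, each of which is the head of one chain. A circuit that runs from both ends of the middle row to
its centre turns each link into a single qubit (`exists_middle_circuit`), which completes the chains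
(`sum_rotatedChains`).
-/

namespace CSSIsing

/-! ### Action of circuits on Pauli operators -/

section Circuits

variable {Q : Type} [Fintype Q] [DecidableEq Q]

/-- The product of the Pauli `X` operators of the qubits where the bit vector `v` is `1`. -/
def xVec (v : Q → ZMod 2) : Op Q := Matrix.of fun s s' => if s = s' + v then 1 else 0

/-- The nontrivial character `a ↦ (-1) ^ a` of `ZMod 2`. -/
def sgn (a : ZMod 2) : ℂ := (-1) ^ a.val

/-- The product of the Pauli `Z` operators of the qubits where the bit vector `v` is `1`. -/
def zVec (v : Q → ZMod 2) : Op Q := Matrix.diagonal fun s => sgn (∑ i, v i * s i)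

/-- The indicator vector over `ZMod 2` of a set of qubits. -/
def ind (S : Finset Q) : Q → ZMod 2 := fun i => if i ∈ S then 1 else 0

lemma sgn_add (a b : ZMod 2) : sgn (a + b) = sgn a * sgn b := by
  rw [sgn, sgn, sgn, ZMod.val_add, ← pow_add]
  exact (neg_one_pow_eq_pow_mod_two _).symm

omit [Fintype Q] in
lemma sgn_sum (S : Finset Q) (f : Q → ZMod 2) : sgn (∑ i ∈ S, f i) = ∏ i ∈ S, sgn (f i) := by
  induction S using Finset.induction_on with
  | empty => simp [sgn]
  | insert a S ha ih => rw [Finset.sum_insert ha, Finset.prod_insert ha, sgn_add, ih]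

lemma pauliX_eq (S : Finset Q) : pauliX S = xVec (ind S) := by
  have h : ∀ s' : Q → ZMod 2, (fun i => if i ∈ S then s' i + 1 else s' i) = s' + ind S := by
    intro s'
    funext i
    by_cases hi : i ∈ S <;> simp [ind, hi]
  simp only [pauliX, xVec, h]

lemma pauliZ_eq (S : Finset Q) : pauliZ S = zVec (ind S) := by
  simp only [pauliZ, zVec, ind, ite_mul, one_mul, zero_mul, Finset.sum_ite_mem, Finset.univ_inter,
    sgn_sum]
  rfl

/-- The action of `cx c t` on bit assignments. -/
def addTo (c t : Q) (v : Q → ZMod 2) : Q → ZMod 2 := Function.update v t (v t + v c)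

omit [Fintype Q] in
lemma addTo_apply (c t : Q) (v : Q → ZMod 2) (q : Q) :
    addTo c t v q = v q + if t = q then v c else 0 := by
  by_cases h : t = q
  · subst h; simp [addTo]
  · simp [addTo, h, Function.update_of_ne (Ne.symm h)]

omit [Fintype Q] in
lemma addTo_addTo {c t : Q} (h : c ≠ t) (v : Q → ZMod 2) : addTo c t (addTo c t v) = v := by
  funext q
  rw [addTo_apply, addTo_apply, addTo_apply, if_neg (Ne.symm h)]
  have h2 := CharTwo.add_self_eq_zero (v c)
  split_ifs
  · rw [add_zero, add_assoc, h2, add_zero]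
  · simp

omit [Fintype Q] in
lemma addTo_add (c t : Q) (v w : Q → ZMod 2) : addTo c t (v + w) = addTo c t v + addTo c t w := by
  funext q
  simp only [addTo_apply, Pi.add_apply]
  split_ifs <;> ring

omit [Fintype Q] in
lemma eq_addTo_comm {c t : Q} (h : c ≠ t) {v w : Q → ZMod 2} :
    v = addTo c t w ↔ w = addTo c t v := by
  constructor <;> rintro rfl <;> rw [addTo_addTo h]

lemma cx_conjTranspose {c t : Q} (h : c ≠ t) : (cx c t).conjTranspose = cx c t := by
  ext s s'
  have := eq_addTo_comm h (v := s) (w := s')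
  simp only [addTo] at this
  simp only [cx, Matrix.conjTranspose_apply, Matrix.of_apply, apply_ite star, star_one, star_zero,
    this]

lemma cx_conj_apply {c t : Q} (h : c ≠ t) (M : Op Q) (s s' : Q → ZMod 2) :
    (cx c t * M * (cx c t).conjTranspose) s s' = M (addTo c t s) (addTo c t s') := by
  have h1 : ∀ a b : Q → ZMod 2, cx c t a b = if b = addTo c t a then 1 else 0 := by
    intro a b
    simp only [cx, Matrix.of_apply]
    exact if_congr (eq_addTo_comm h) rfl rfl
  rw [cx_conjTranspose h, Matrix.mul_apply]
  simp_rw [Matrix.mul_apply]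
  have h2 : ∀ a b : Q → ZMod 2, cx c t a b = if a = addTo c t b then 1 else 0 := fun a b => rfl
  simp only [h2 _ s']
  simp only [h1, ite_mul, one_mul, zero_mul, mul_ite, mul_one, mul_zero,
    Finset.sum_ite_eq', Finset.mem_univ, if_true]

lemma cx_conj_xVec {c t : Q} (h : c ≠ t) (v : Q → ZMod 2) :
    cx c t * xVec v * (cx c t).conjTranspose = xVec (addTo c t v) := by
  ext s s'
  rw [cx_conj_apply h]
  simp only [xVec, Matrix.of_apply]
  refine if_congr ?_ rfl rfl
  rw [eq_comm, eq_addTo_comm h, addTo_add, addTo_addTo h]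

/-- On products of `Z` operators the control and the target of a gate change roles. -/
lemma cx_conj_zVec {c t : Q} (h : c ≠ t) (v : Q → ZMod 2) :
    cx c t * zVec v * (cx c t).conjTranspose = zVec (addTo t c v) := by
  ext s s'
  rw [cx_conj_apply h]
  have hs : addTo c t s = addTo c t s' ↔ s = s' :=
    ⟨fun e => by rw [← addTo_addTo h s, e, addTo_addTo h], fun e => by rw [e]⟩
  simp only [zVec, Matrix.diagonal_apply, hs]
  refine if_congr Iff.rfl (congrArg sgn ?_) rfl
  simp only [addTo_apply, mul_add, add_mul, Finset.sum_add_distrib, mul_ite, ite_mul, mul_zero,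
    zero_mul, Finset.sum_ite_eq, Finset.mem_univ, if_true]

lemma conj_eq_foldl (C : List (List (Q × Q))) (H : Op Q) :
    conj C H = C.flatten.foldl (fun M g => cx g.1 g.2 * M * (cx g.1 g.2).conjTranspose) H := by
  have key : ∀ (l : List (Q × Q)) (A : Op Q),
      l.foldl (fun U g => cx g.1 g.2 * U) A * H *
        (l.foldl (fun U g => cx g.1 g.2 * U) A).conjTranspose =
      l.foldl (fun M g => cx g.1 g.2 * M * (cx g.1 g.2).conjTranspose)
        (A * H * A.conjTranspose) := by
    intro l
    induction l with
    | nil => intro A; rfl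
    | cons g l ih =>
      intro A
      rw [List.foldl_cons, List.foldl_cons, ih, Matrix.conjTranspose_mul]
      simp only [Matrix.mul_assoc]
  rw [conj, circuitOp, key]
  simp

lemma conj_add (C : List (List (Q × Q))) (A B : Op Q) : conj C (A + B) = conj C A + conj C B := by
  simp only [conj, Matrix.mul_add, Matrix.add_mul]

lemma conj_neg (C : List (List (Q × Q))) (A : Op Q) : conj C (-A) = -conj C A := by
  simp only [conj, Matrix.mul_neg, Matrix.neg_mul]

lemma conj_sub (C : List (List (Q × Q))) (A B : Op Q) : conj C (A - B) = conj C A - conj C B := by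
  rw [sub_eq_add_neg, conj_add, conj_neg, sub_eq_add_neg]

lemma conj_sum (C : List (List (Q × Q))) {ι : Type*} (S : Finset ι) (A : ι → Op Q) :
    conj C (∑ i ∈ S, A i) = ∑ i ∈ S, conj C (A i) := by
  simp only [conj, Finset.mul_sum, Finset.sum_mul]

lemma conj_xVec {C : List (List (Q × Q))} (hC : ∀ l ∈ C, ∀ g ∈ l, g.1 ≠ g.2) (v : Q → ZMod 2) :
    conj C (xVec v) = xVec (C.foldl (fun u l => l.foldl (fun u g => addTo g.1 g.2 u) u) v) := by
  rw [conj_eq_foldl, ← List.foldl_flatten]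
  have : ∀ g ∈ C.flatten, g.1 ≠ g.2 := by
    intro g hg
    obtain ⟨l, hl, hgl⟩ := List.mem_flatten.1 hg
    exact hC l hl g hgl
  generalize C.flatten = l at this
  induction l generalizing v with
  | nil => rfl
  | cons g l ih =>
    rw [List.foldl_cons, List.foldl_cons, cx_conj_xVec (this g (by simp)), ih _
      (fun g hg => this g (by simp [hg]))]

lemma conj_zVec {C : List (List (Q × Q))} (hC : ∀ l ∈ C, ∀ g ∈ l, g.1 ≠ g.2) (v : Q → ZMod 2) :
    conj C (zVec v) = zVec (C.foldl (fun u l => l.foldl (fun u g => addTo g.2 g.1 u) u) v) := by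
  rw [conj_eq_foldl, ← List.foldl_flatten]
  have : ∀ g ∈ C.flatten, g.1 ≠ g.2 := by
    intro g hg
    obtain ⟨l, hl, hgl⟩ := List.mem_flatten.1 hg
    exact hC l hl g hgl
  generalize C.flatten = l at this
  induction l generalizing v with
  | nil => rfl
  | cons g l ih =>
    rw [List.foldl_cons, List.foldl_cons, cx_conj_zVec (this g (by simp)), ih _
      (fun g hg => this g (by simp [hg]))]

omit [Fintype Q] in
lemma foldl_addTo_apply {l : List (Q × Q)} (hl : ∀ g ∈ l, ∀ h ∈ l, g.1 ≠ h.2)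
    (v : Q → ZMod 2) (q : Q) :
    l.foldl (fun u g => addTo g.1 g.2 u) v q =
      v q + (l.map fun g => if g.2 = q then v g.1 else 0).sum := by
  induction l generalizing v with
  | nil => simp
  | cons g l ih =>
    rw [List.foldl_cons, ih (fun a ha b hb => hl a (by simp [ha]) b (by simp [hb])),
      List.map_cons, List.sum_cons, addTo_apply, add_assoc]
    congr 3
    refine List.map_congr_left fun a ha => ?_
    rw [addTo_apply, if_neg (Ne.symm (hl a (by simp [ha]) g (by simp))), add_zero]

end Circuits

/-! ### Unitriangular circuits -/

section Triangular

variable {Q : Type} [Fintype Q] [DecidableEq Q]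

/-- The gates with control in `par q` and target `q`, for all `q` of rank `k`. -/
noncomputable def rankLayer (par : Q → Finset Q) (r : Q → ℕ) (k : ℕ) : List (Q × Q) :=
  (Finset.univ.filter fun g : Q × Q => g.1 ∈ par g.2 ∧ r g.2 = k).toList

/-- The circuit that adds, in the order of the rank of `q` and for ranks `1` to `D`, the bits of
the parents `par q` to the bit of `q`. -/
noncomputable def rankCircuit (par : Q → Finset Q) (r : Q → ℕ) (D : ℕ) : List (List (Q × Q)) :=
  (List.range D).map fun k => rankLayer par r (k + 1)

/-- The circuit in which the control and the target of each gate are exchanged. It acts on products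
of `Z` operators as the original circuit acts on products of `X` operators. -/
def reverseGates (C : List (List (Q × Q))) : List (List (Q × Q)) :=
  C.map (List.map Prod.swap)

variable {par : Q → Finset Q} {r : Q → ℕ}

lemma mem_rankLayer {k : ℕ} {g : Q × Q} :
    g ∈ rankLayer par r k ↔ g.1 ∈ par g.2 ∧ r g.2 = k := by
  simp [rankLayer]

lemma rankLayer_separated (hr : ∀ q, ∀ t ∈ par q, r t < r q) (k : ℕ) :
    ∀ g ∈ rankLayer par r k, ∀ h ∈ rankLayer par r k, g.1 ≠ h.2 := by
  intro g hg h hh e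
  rw [mem_rankLayer] at hg hh
  have := hr _ _ hg.1
  rw [e] at this
  omega

lemma isCircuit_rankCircuit {near : Q → Q → Prop} (hr : ∀ q, ∀ t ∈ par q, r t < r q)
    (hnear : ∀ q, ∀ t ∈ par q, near t q) (D : ℕ) : IsCircuit near (rankCircuit par r D) := by
  intro l hl
  obtain ⟨k, -, rfl⟩ := List.mem_map.1 hl
  exact ⟨Finset.nodup_toList _, rankLayer_separated hr _,
    fun g hg => hnear _ _ (mem_rankLayer.1 hg).1⟩

omit [Fintype Q] [DecidableEq Q] in
lemma IsCircuit.reverseGates {near : Q → Q → Prop} {C : List (List (Q × Q))}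
    (hC : IsCircuit (fun c t => near t c) C) : IsCircuit near (reverseGates C) := by
  intro l hl
  obtain ⟨l, hl', rfl⟩ := List.mem_map.1 hl
  obtain ⟨h1, h2, h3⟩ := hC l hl'
  refine ⟨h1.map Prod.swap_injective, ?_, ?_⟩
  · intro g hg h hh
    obtain ⟨g, hg', rfl⟩ := List.mem_map.1 hg
    obtain ⟨h, hh', rfl⟩ := List.mem_map.1 hh
    exact (h2 h hh' g hg').symm
  · intro g hg
    obtain ⟨g, hg', rfl⟩ := List.mem_map.1 hg
    exact h3 g hg'

lemma rankLayer_apply (hr : ∀ q, ∀ t ∈ par q, r t < r q) (k : ℕ) (v : Q → ZMod 2) (q : Q) :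
    (rankLayer par r k).foldl (fun u g => addTo g.1 g.2 u) v q =
      v q + if r q = k then ∑ t ∈ par q, v t else 0 := by
  rw [foldl_addTo_apply (rankLayer_separated hr k), rankLayer, Finset.sum_map_toList,
    Finset.sum_filter, Fintype.sum_prod_type_right, Finset.sum_eq_single q]
  · congr 1
    by_cases h : r q = k <;> simp [h]
  · intro b _ hb
    exact Finset.sum_eq_zero fun a _ => by simp [hb]
  · simp

lemma rankLayer_apply_swap (hr : ∀ q, ∀ t ∈ par q, r t < r q) (k : ℕ) (v : Q → ZMod 2) (t : Q) :
    (rankLayer par r k).foldl (fun u g => addTo g.2 g.1 u) v t =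
      v t + ∑ q with t ∈ par q ∧ r q = k, v q := by
  have h1 := foldl_addTo_apply (l := (rankLayer par r k).map Prod.swap) (v := v) (q := t) (by
    intro g hg h hh
    obtain ⟨g, hg', rfl⟩ := List.mem_map.1 hg
    obtain ⟨h, hh', rfl⟩ := List.mem_map.1 hh
    exact (rankLayer_separated hr k h hh' g hg').symm)
  rw [List.foldl_map, List.map_map] at h1
  refine h1.trans ?_
  rw [rankLayer, Finset.sum_map_toList, Finset.sum_filter, Fintype.sum_prod_type,
    Finset.sum_eq_single t]
  · simp [Finset.sum_filter]
  · intro b _ hb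
    exact Finset.sum_eq_zero fun a _ => by simp [hb]
  · simp

/-- The parents of `q` have smaller rank, so that they already carry their final bits when these
are added to `q`; this inverts the unitriangular relation between `v` and `w`. -/
lemma rankCircuit_foldl (hr : ∀ q, ∀ t ∈ par q, r t < r q) {v w : Q → ZMod 2}
    (h : ∀ q, v q = w q + ∑ t ∈ par q, w t) (D : ℕ) (q : Q) :
    (rankCircuit par r D).foldl (fun u l => l.foldl (fun u g => addTo g.1 g.2 u) u) v q =
      if r q ≤ D then w q else v q := by
  induction D generalizing q with
  | zero =>
    split_ifs with hq
    · have : par q = ∅ := Finset.eq_empty_of_forall_notMem fun t ht => by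
        have := hr q t ht; omega
      simp [rankCircuit, h, this]
    · rfl
  | succ D ih =>
    rw [rankCircuit, List.range_succ, List.map_append, List.foldl_append]
    simp only [List.map_cons, List.map_nil, List.foldl_cons, List.foldl_nil]
    rw [← rankCircuit, rankLayer_apply hr, ih]
    rcases lt_trichotomy (r q) (D + 1) with hq | hq | hq
    · rw [if_pos (by omega), if_neg (by omega), if_pos (by omega), add_zero]
    · rw [if_neg (by omega), if_pos hq, if_pos (by omega), h q, add_assoc]
      rw [Finset.sum_congr rfl fun t ht => (ih t).trans (if_pos (by have := hr q t ht; omega)),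
        CharTwo.add_self_eq_zero, add_zero]
    · rw [if_neg (by omega), if_neg (by omega), if_neg (by omega), add_zero]

/-- The transposed action. The children of `q` have larger rank, so that `q` still carries its
initial bit when this is added to its parents. -/
lemma rankCircuit_foldl_swap (hr : ∀ q, ∀ t ∈ par q, r t < r q) (v : Q → ZMod 2) (D : ℕ) (t : Q) :
    (rankCircuit par r D).foldl (fun u l => l.foldl (fun u g => addTo g.2 g.1 u) u) v t =
      v t + ∑ q with t ∈ par q ∧ r q ≤ D, v q := by
  induction D generalizing t with
  | zero =>
    rw [Finset.sum_eq_zero, add_zero]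
    · rfl
    · intro q hq
      have h1 := (Finset.mem_filter.1 hq).2
      have := hr q t h1.1
      omega
  | succ D ih =>
    rw [rankCircuit, List.range_succ, List.map_append, List.foldl_append]
    simp only [List.map_cons, List.map_nil, List.foldl_cons, List.foldl_nil]
    rw [← rankCircuit, rankLayer_apply_swap hr, ih, add_assoc]
    congr 1
    rw [Finset.sum_filter, Finset.sum_filter, Finset.sum_filter, ← Finset.sum_add_distrib]
    refine Finset.sum_congr rfl fun q _ => ?_
    by_cases hq : t ∈ par q ∧ r q = D + 1
    · rw [if_neg (fun h => by have := h.2; omega), if_pos hq, if_pos ⟨hq.1, hq.2.le⟩,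
        zero_add, ih, Finset.sum_eq_zero, add_zero]
      intro p hp
      have h1 := (Finset.mem_filter.1 hp).2
      have := hr p q h1.1
      omega
    · rw [if_neg hq, add_zero]
      refine if_congr ?_ rfl rfl
      constructor
      · rintro ⟨h1, h2⟩; exact ⟨h1, by omega⟩
      · rintro ⟨h1, h2⟩; exact ⟨h1, by by_contra h3; exact hq ⟨h1, by omega⟩⟩

lemma rankCircuit_ne (hr : ∀ q, ∀ t ∈ par q, r t < r q) (D : ℕ) :
    ∀ l ∈ rankCircuit par r D, ∀ g ∈ l, g.1 ≠ g.2 := by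
  intro l hl g hg
  obtain ⟨k, -, rfl⟩ := List.mem_map.1 hl
  exact rankLayer_separated hr _ g hg g hg

lemma conj_rankCircuit_xVec (hr : ∀ q, ∀ t ∈ par q, r t < r q) {D : ℕ} (hD : ∀ q, r q ≤ D)
    {v w : Q → ZMod 2} (h : ∀ q, v q = w q + ∑ t ∈ par q, w t) :
    conj (rankCircuit par r D) (xVec v) = xVec w := by
  rw [conj_xVec (rankCircuit_ne hr D)]
  congr 1
  funext q
  rw [rankCircuit_foldl hr h, if_pos (hD q)]

lemma conj_rankCircuit_zVec (hr : ∀ q, ∀ t ∈ par q, r t < r q) {D : ℕ} (hD : ∀ q, r q ≤ D)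
    (v : Q → ZMod 2) :
    conj (rankCircuit par r D) (zVec v) = zVec fun t => v t + ∑ q with t ∈ par q, v q := by
  rw [conj_zVec (rankCircuit_ne hr D)]
  congr 1
  funext q
  rw [rankCircuit_foldl_swap hr]
  simp only [hD, and_true]

lemma conj_reverseGates_zVec (hr : ∀ q, ∀ t ∈ par q, r t < r q) {D : ℕ} (hD : ∀ q, r q ≤ D)
    {v w : Q → ZMod 2} (h : ∀ q, v q = w q + ∑ t ∈ par q, w t) :
    conj (reverseGates (rankCircuit par r D)) (zVec v) = zVec w := by
  rw [conj_zVec]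
  · congr 1
    funext q
    rw [reverseGates, List.foldl_map]
    simp only [List.foldl_map, Prod.fst_swap, Prod.snd_swap]
    rw [rankCircuit_foldl hr h, if_pos (hD q)]
  · intro l hl g hg
    obtain ⟨l, hl', rfl⟩ := List.mem_map.1 hl
    obtain ⟨g, hg', rfl⟩ := List.mem_map.1 hg
    exact (rankCircuit_ne hr D l hl' g hg').symm

lemma conj_reverseGates_pauliZ (hr : ∀ q, ∀ t ∈ par q, r t < r q) {D : ℕ} (hD : ∀ q, r q ≤ D)
    {S T : Finset Q} (h : ∀ q, ind S q = ind T q + ∑ t ∈ par q, ind T t) :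
    conj (reverseGates (rankCircuit par r D)) (pauliZ S) = pauliZ T := by
  rw [pauliZ_eq, pauliZ_eq, conj_reverseGates_zVec hr hD h]

end Triangular

/-! ### Reduction of the cells of a forest to single qubits -/

section Forest

variable {Q V : Type} [Fintype Q] [DecidableEq Q]

/-- Each cell `u` is assigned a qubit `te u` of its support. The parents of `q` are the assigned
qubits, other than `q`, of the cells that contain `q`. -/
def forestParents (cells : Finset V) (S : V → Finset Q) (te : V → Q) (q : Q) : Finset Q :=
  ((cells.filter fun u => q ∈ S u).image te).erase q

variable {cells : Finset V} {S : V → Finset Q} {te : V → Q} {r : Q → ℕ}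

omit [Fintype Q] in
lemma mem_forestParents {q t : Q} :
    t ∈ forestParents cells S te q ↔ t ≠ q ∧ ∃ u ∈ cells, q ∈ S u ∧ te u = t := by
  simp [forestParents, and_assoc]

omit [Fintype Q] in
/-- For `w` supported on the assigned qubits, `q` together with its parents collects the value of
`w` at the assigned qubit of each cell that contains `q`. -/
lemma sum_forestParents (hinj : Set.InjOn te cells) (hmem : ∀ u ∈ cells, te u ∈ S u)
    {w : Q → ZMod 2} (hw : ∀ q, q ∉ cells.image te → w q = 0) (q : Q) :
    w q + ∑ t ∈ forestParents cells S te q, w t = ∑ u ∈ cells with q ∈ S u, w (te u) := by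
  rw [← Finset.sum_image (f := w) (g := te)
    (fun a ha b hb => hinj (Finset.mem_filter.1 ha).1 (Finset.mem_filter.1 hb).1)]
  by_cases hq : q ∈ cells.image te
  · obtain ⟨u, hu, rfl⟩ := Finset.mem_image.1 hq
    exact Finset.add_sum_erase _ _
      (Finset.mem_image_of_mem _ (Finset.mem_filter.2 ⟨hu, hmem u hu⟩))
  · rw [hw q hq, zero_add, forestParents, Finset.erase_eq_of_notMem]
    exact fun h => hq (Finset.image_subset_image (Finset.filter_subset _ _) h)

/-- If the rank increases from the assigned qubit of a cell to the other qubits of the cell, a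
circuit with one layer per rank turns the `X` operator of each cell into the `X` operator of its
assigned qubit. A product of `Z` operators that commutes with all the cells merely loses its factors
on assigned qubits. The set `R` in the second assertion is the product of all the cells. -/
theorem exists_forest_circuit (hinj : Set.InjOn te cells) (hmem : ∀ u ∈ cells, te u ∈ S u)
    (hr : ∀ u ∈ cells, ∀ q ∈ S u, q ≠ te u → r (te u) < r q) {D : ℕ} (hD : ∀ q, r q ≤ D)
    {near : Q → Q → Prop} (hnear : ∀ u ∈ cells, ∀ p ∈ S u, ∀ q ∈ S u, near p q) :
    ∃ U : List (List (Q × Q)), IsCircuit near U ∧ U.length = D ∧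
      (∀ u ∈ cells, conj U (pauliX (S u)) = pauliX {te u}) ∧
      (∀ R : Finset Q, (∀ q, ind R q = ∑ u ∈ cells, ind (S u) q) →
        conj U (pauliX R) = pauliX (cells.image te)) ∧
      ∀ P : Finset Q, (∀ u ∈ cells, ∑ q ∈ S u, ind P q = 0) →
        conj U (pauliZ P) = pauliZ (P \ cells.image te) := by
  have hr' : ∀ q, ∀ t ∈ forestParents cells S te q, r t < r q := by
    intro q t ht
    obtain ⟨h1, u, hu, hq, rfl⟩ := mem_forestParents.1 ht
    exact hr u hu q hq h1.symm
  refine ⟨rankCircuit (forestParents cells S te) r D, isCircuit_rankCircuit hr' ?_ D,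
    by simp [rankCircuit], ?_, ?_, ?_⟩
  · intro q t ht
    obtain ⟨h1, u, hu, hq, rfl⟩ := mem_forestParents.1 ht
    exact hnear u hu _ (hmem u hu) _ hq
  · intro u hu
    rw [pauliX_eq, pauliX_eq]
    refine conj_rankCircuit_xVec hr' hD fun q => ?_
    rw [sum_forestParents hinj hmem]
    · rw [Finset.sum_filter, Finset.sum_eq_single_of_mem u hu]
      · simp [ind]
      · intro b hb hbu
        have : te b ≠ te u := fun h => hbu (hinj hb hu h)
        simp [ind, this]
    · intro q hq
      have : q ≠ te u := fun h => hq (h ▸ Finset.mem_image_of_mem _ hu)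
      simp [ind, this]
  · intro R hR
    rw [pauliX_eq, pauliX_eq]
    refine conj_rankCircuit_xVec hr' hD fun q => ?_
    rw [sum_forestParents hinj hmem, hR, Finset.sum_filter]
    · refine Finset.sum_congr rfl fun u hu => ?_
      have : te u ∈ cells.image te := Finset.mem_image_of_mem _ hu
      simp [ind, this, -Finset.mem_image]
    · intro q hq
      simp [ind, hq, -Finset.mem_image]
  · intro P hP
    rw [pauliZ_eq, pauliZ_eq, conj_rankCircuit_zVec hr' hD]
    congr 1
    funext t
    by_cases ht : t ∈ cells.image te
    · obtain ⟨u, hu, rfl⟩ := Finset.mem_image.1 ht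
      have h1 : (Finset.univ.filter fun q => te u ∈ forestParents cells S te q) =
          (S u).erase (te u) := by
        ext q
        simp only [Finset.mem_filter, Finset.mem_univ, true_and, mem_forestParents,
          Finset.mem_erase]
        constructor
        · rintro ⟨h1, b, hb, hq, e⟩
          rw [hinj hb hu e] at hq
          exact ⟨h1.symm, hq⟩
        · rintro ⟨h1, h2⟩
          exact ⟨h1.symm, u, hu, h2, rfl⟩
      rw [h1, Finset.add_sum_erase _ _ (hmem u hu), hP u hu]
      simp [ind, -Finset.mem_image, ht]
    · rw [Finset.sum_eq_zero, add_zero]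
      · simp [ind, -Finset.mem_image, ht]
      · intro q hq
        obtain ⟨-, u, hu, -, rfl⟩ := mem_forestParents.1 (Finset.mem_filter.1 hq).2
        exact absurd (Finset.mem_image_of_mem _ hu) ht

end Forest

/-! ### From the parity check to the Ising loop -/

lemma val_finRotate {N : ℕ} (j : Fin N) :
    (finRotate N j).val = if j.val + 1 = N then 0 else j.val + 1 := by
  obtain _ | n := N
  · exact j.elim0
  · split_ifs with h
    · have : j = Fin.last n := Fin.ext (by simpa using h)
      rw [this, finRotate_last]; rfl
    · exact coe_finRotate_of_ne_last fun e => h (by rw [e]; rfl)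

section Loop

variable {Q : Type} [Fintype Q] [DecidableEq Q]

omit [Fintype Q] in
lemma ind_pair {a b : Q} (h : a ≠ b) (q : Q) :
    ind {a, b} q = (if q = a then 1 else 0) + if q = b then 1 else 0 := by
  by_cases ha : q = a
  · subst ha; simp [ind, h]
  · by_cases hb : q = b
    · subst hb; simp [ind, ha]
    · simp [ind, ha, hb]

/-- The qubit `a 0` does not occur in the parity check. With `e j` for the terms, the global one
being `e 0`, the qubit `a i` occurs in `e i` and `e 0` if `i ≠ 0`, and it has to occur in
`e (i - 1)` and `e i`. Telescoping, the former is the sum of the latter over the qubits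
`a 1, …, a i`, and the latter sum to zero over the whole loop, which gives the parents of `a i` and
of `a 0`. -/
theorem exists_parityCheck_loop_circuit {N : ℕ} (hN : 2 ≤ N) {a : Fin N → Q}
    (ha : Function.Injective a) :
    ∃ VX : List (List (Q × Q)),
      IsCircuit (fun c t => c ∈ Set.range a ∧ t ∈ Set.range a) VX ∧
      conj VX (parityCheck pauliX ((Finset.univ.filter fun i : Fin N => i.val ≠ 0).image a)) =
        isingLoop pauliX a := by
  set F : Fin N → Finset (Fin N) := fun i =>
    Finset.univ.filter fun j => j.val ≠ 0 ∧ (i.val = 0 ∨ j.val < i.val) with hF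
  set par : Q → Finset Q := Function.extend a (fun i => (F i).image a) fun _ => ∅ with hpar
  set r : Q → ℕ := Function.extend a (fun i => if i.val = 0 then N else i.val) fun _ => 0 with hrdef
  have hpara : ∀ i, par (a i) = (F i).image a := fun i => ha.extend_apply _ _ i
  have hra : ∀ i, r (a i) = if i.val = 0 then N else i.val := fun i => ha.extend_apply _ _ i
  have hpar0 : ∀ q, q ∉ Set.range a → par q = ∅ := fun q hq =>
    Function.extend_apply' _ _ _ hq
  have hr0 : ∀ q, q ∉ Set.range a → r q = 0 := fun q hq => Function.extend_apply' _ _ _ hq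
  have hmem : ∀ q, ∀ t ∈ par q, t ∈ Set.range a ∧ q ∈ Set.range a ∧ r t < r q := by
    intro q t ht
    by_cases hq : q ∈ Set.range a
    · obtain ⟨i, rfl⟩ := hq
      rw [hpara] at ht
      obtain ⟨j, hj, rfl⟩ := Finset.mem_image.1 ht
      refine ⟨⟨j, rfl⟩, ⟨i, rfl⟩, ?_⟩
      have hj := (Finset.mem_filter.1 hj).2
      have := j.isLt
      rw [hra, hra]
      split_ifs <;> omega
    · rw [hpar0 q hq] at ht
      simp at ht
  have hr := fun q t ht => (hmem q t ht).2.2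
  have hD : ∀ q, r q ≤ N := by
    intro q
    by_cases hq : q ∈ Set.range a
    · obtain ⟨i, rfl⟩ := hq
      have := i.isLt
      rw [hra]
      split_ifs <;> omega
    · rw [hr0 q hq]; omega
  set qx := (Finset.univ.filter fun i : Fin N => i.val ≠ 0).image a with hqx
  set T : Fin N → Finset Q := fun j => if j.val = 0 then qx else {a j} with hT
  have hterm : ∀ j, conj (rankCircuit par r N) (pauliX (T j)) =
      pauliX {a j, a (finRotate N j)} := by
    intro j
    rw [pauliX_eq, pauliX_eq]
    refine conj_rankCircuit_xVec hr hD fun q => ?_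
    set j' := finRotate N j with hj'
    have hjv : j'.val = if j.val + 1 = N then 0 else j.val + 1 := val_finRotate j
    have hne : j ≠ j' := by
      intro e
      have := congrArg Fin.val e
      have := j.isLt
      rw [hjv] at *
      split_ifs at * <;> omega
    have hw : ∀ i, ind {a j, a j'} (a i) = (if i = j then 1 else 0) + if i = j' then 1 else 0 := by
      intro i
      rw [ind_pair (ha.ne hne)]
      simp only [ha.eq_iff]
    by_cases hq : q ∈ Set.range a
    · obtain ⟨i, rfl⟩ := hq
      rw [hpara, Finset.sum_image (fun x _ y _ h => ha h), hw]
      simp only [hw, Finset.sum_add_distrib, Finset.sum_ite_eq']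
      have hv : ind (T j) (a i) =
          if (j.val = 0 ∧ i.val ≠ 0) ∨ (j.val ≠ 0 ∧ i.val = j.val) then 1 else 0 := by
        simp only [ind, hT]
        refine if_congr ?_ rfl rfl
        split_ifs with h0
        · simp [hqx, ha.eq_iff, h0]
        · simp [ha.eq_iff, h0, Fin.ext_iff]
      rw [hv]
      simp only [hF, Finset.mem_filter, Finset.mem_univ, true_and, Fin.ext_iff, hjv]
      have := i.isLt
      have := j.isLt
      split_ifs <;> first | omega | decide
    · have h1 : q ∉ T j := by
        intro h
        simp only [hT] at h
        split_ifs at h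
        · obtain ⟨i, -, rfl⟩ := Finset.mem_image.1 h
          exact hq ⟨i, rfl⟩
        · exact hq ⟨j, (Finset.mem_singleton.1 h).symm⟩
      have h2 : q ∉ ({a j, a j'} : Finset Q) := by
        intro h
        rcases Finset.mem_insert.1 h with h | h
        · exact hq ⟨j, h.symm⟩
        · exact hq ⟨j', (Finset.mem_singleton.1 h).symm⟩
      rw [hpar0 q hq]
      simp only [ind, if_neg h1, if_neg h2, Finset.sum_empty, add_zero]
  refine ⟨rankCircuit par r N, isCircuit_rankCircuit hr
    (fun q t ht => ⟨(hmem q t ht).1, (hmem q t ht).2.1⟩) N, ?_⟩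
  have hH : parityCheck pauliX qx = -∑ j, pauliX (T j) := by
    have h0 : (⟨0, by omega⟩ : Fin N) ∈ Finset.univ := Finset.mem_univ _
    rw [parityCheck, ← Finset.add_sum_erase _ _ h0, neg_add_rev, hqx,
      Finset.sum_image (fun x _ y _ h => ha h), sub_eq_add_neg]
    congr 2
    refine Finset.sum_congr ?_ fun i hi => ?_
    · ext i
      simp [Fin.ext_iff]
    · have := (Finset.mem_erase.1 hi).1
      simp only [hT]
      rw [if_neg fun h => this (Fin.ext h)]
  rw [hH, conj_neg, conj_sum, isingLoop]
  simp only [hterm]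

end Loop

/-! ### A spanning tree of the torus -/

section ToricTree

variable {L : ℕ} [NeZero L]

lemma val_add_one_eq (hL : 2 ≤ L) (x : ZMod L) :
    (x + 1).val = if x.val + 1 = L then 0 else x.val + 1 := by
  have : Fact (1 < L) := ⟨hL⟩
  have hx := x.val_lt
  rw [ZMod.val_add, ZMod.val_one]
  split_ifs with h
  · rw [h, Nat.mod_self]
  · exact Nat.mod_eq_of_lt (by omega)

lemma val_sub_one_eq (hL : 2 ≤ L) (x : ZMod L) :
    (x - 1).val = if x.val = 0 then L - 1 else x.val - 1 := by
  have h := val_add_one_eq hL (x - 1)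
  have h1 := (x - 1).val_lt
  rw [sub_add_cancel] at h
  split_ifs at h ⊢ <;> omega

lemma val_ext (L : ℕ) [NeZero L] {x y : ZMod L} : x = y ↔ x.val = y.val :=
  (ZMod.val_injective L).eq_iff.symm

omit [NeZero L] in
lemma vertex_ne_zero_iff {u : ZMod L × ZMod L} : u ≠ 0 ↔ u.1.val ≠ 0 ∨ u.2.val ≠ 0 := by
  rw [ne_eq, Prod.ext_iff, Prod.fst_zero, Prod.snd_zero, ← ZMod.val_eq_zero, ← ZMod.val_eq_zero]
  tauto

/-- The first edge of the path from the vertex `u` to the root `(0, 0)` in the comb-shaped spanning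
tree: the path goes along the row of `u` to the column `0`, then along this column, in both cases
in the direction that does not cross the edge at position `L / 2`. The value at the root is not
used. -/
def treeEdge (u : ZMod L × ZMod L) : TQubit L :=
  if u.1.val = 0 then (u.1, if u.2.val ≤ L / 2 then u.2 - 1 else u.2, true)
  else (if u.1.val ≤ L / 2 then u.1 - 1 else u.1, u.2, false)

/-- The distance from the root to the nearer end point of a tree edge. The edges outside the tree
come last; the tree has depth `2 * (L / 2)`. -/
def toricRank (q : TQubit L) : ℕ :=
  if q.2.2 then
    if q.1.val = 0 then
      if q.2.1.val < L / 2 then q.2.1.val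
      else if q.2.1.val = L / 2 then 2 * (L / 2) else L - q.2.1.val - 1
    else 2 * (L / 2)
  else
    if q.1.val = L / 2 then 2 * (L / 2)
    else
      (if q.1.val < L / 2 then q.1.val else L - q.1.val - 1) +
        if q.2.1.val ≤ L / 2 then q.2.1.val else L - q.2.1.val

/-- The edges of the spanning tree. -/
def toricTree (L : ℕ) [NeZero L] : Finset (TQubit L) :=
  (Finset.univ.erase (0 : ZMod L × ZMod L)).image treeEdge

omit [NeZero L] in
lemma mem_vertexStar_false {x y a b : ZMod L} :
    (a, b, false) ∈ vertexStar x y ↔ b = y ∧ (a = x ∨ a = x - 1) := by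
  simp [vertexStar]; tauto

omit [NeZero L] in
lemma mem_vertexStar_true {x y a b : ZMod L} :
    (a, b, true) ∈ vertexStar x y ↔ a = x ∧ (b = y ∨ b = y - 1) := by
  simp [vertexStar]; tauto

omit [NeZero L] in
lemma mem_plaquette_false {x y a b : ZMod L} :
    (a, b, false) ∈ plaquette x y ↔ a = x ∧ (b = y ∨ b = y + 1) := by
  simp [plaquette]; tauto

omit [NeZero L] in
lemma mem_plaquette_true {x y a b : ZMod L} :
    (a, b, true) ∈ plaquette x y ↔ b = y ∧ (a = x ∨ a = x + 1) := by
  simp [plaquette]; tauto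

lemma toricRank_le (q : TQubit L) : toricRank q ≤ 2 * (L / 2) := by
  obtain ⟨x, y, s⟩ := q
  have := x.val_lt
  have := y.val_lt
  simp only [toricRank]
  split_ifs <;> omega

omit [NeZero L] in
lemma treeEdge_mem (u : ZMod L × ZMod L) : treeEdge u ∈ vertexStar u.1 u.2 := by
  obtain ⟨x, y⟩ := u
  simp only [treeEdge]
  split_ifs <;> simp [vertexStar]

lemma treeEdge_injOn (hL : 2 ≤ L) :
    Set.InjOn treeEdge (↑(Finset.univ.erase (0 : ZMod L × ZMod L)) : Set (ZMod L × ZMod L)) := by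
  rintro ⟨x, y⟩ h0 ⟨x', y'⟩ h0' h
  have h1 := x.val_lt
  have h2 := y.val_lt
  have h3 := x'.val_lt
  have h4 := y'.val_lt
  simp only [Finset.coe_erase, Set.mem_sdiff, Set.mem_singleton_iff, Prod.ext_iff, Prod.fst_zero,
    Prod.snd_zero, val_ext L, ZMod.val_zero] at h0 h0' ⊢
  simp only [treeEdge] at h
  split_ifs at h <;>
    simp only [Prod.ext_iff, val_ext L, val_sub_one_eq hL, Bool.true_eq_false,
      Bool.false_eq_true, and_false, and_true] at h <;>
    grind

lemma toricRank_treeEdge_lt (hL : 2 ≤ L) {u : ZMod L × ZMod L} (hu : u ≠ 0) {q : TQubit L}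
    (hq : q ∈ vertexStar u.1 u.2) (hne : q ≠ treeEdge u) :
    toricRank (treeEdge u) < toricRank q := by
  obtain ⟨x, y⟩ := u
  obtain ⟨a, b, s⟩ := q
  have h1 := x.val_lt
  have h2 := y.val_lt
  have h3 := a.val_lt
  have h4 := b.val_lt
  rw [vertex_ne_zero_iff] at hu
  simp only [treeEdge] at hne ⊢
  cases s
  · rw [mem_vertexStar_false] at hq
    obtain ⟨rfl, hq⟩ := hq
    simp only [val_ext L, val_sub_one_eq hL] at hq
    by_cases hx : x.val = 0
    · simp only [hx, if_true, toricRank, apply_ite ZMod.val, val_sub_one_eq hL] at hq ⊢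
      grind
    · simp only [if_neg hx, ne_eq, Prod.mk.injEq, and_true, val_ext L, apply_ite ZMod.val,
        val_sub_one_eq hL] at hne
      simp only [if_neg hx, toricRank, apply_ite ZMod.val, val_sub_one_eq hL]
      grind
  · rw [mem_vertexStar_true] at hq
    obtain ⟨rfl, hq⟩ := hq
    simp only [val_ext L, val_sub_one_eq hL] at hq
    by_cases hx : a.val = 0
    · simp only [if_pos hx, ne_eq, Prod.mk.injEq, true_and, and_true, val_ext L, apply_ite ZMod.val,
        val_sub_one_eq hL] at hne
      simp only [if_pos hx, toricRank, apply_ite ZMod.val, val_sub_one_eq hL]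
      grind
    · simp only [if_neg hx, toricRank, apply_ite ZMod.val, val_sub_one_eq hL]
      grind

lemma mem_toricTree_false (hL : 2 ≤ L) {a b : ZMod L} :
    (a, b, false) ∈ toricTree L ↔ a.val ≠ L / 2 := by
  simp only [toricTree, Finset.mem_image, Finset.mem_erase, Finset.mem_univ, and_true]
  have h3 := a.val_lt
  constructor
  · rintro ⟨⟨x, y⟩, h0, h⟩
    have h1 := x.val_lt
    simp only [treeEdge] at h
    split_ifs at h <;>
    simp only [Prod.ext_iff, val_ext L, val_sub_one_eq hL, Bool.true_eq_false,
      and_false, and_true] at h <;>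
    grind
  · intro h
    by_cases h1 : a.val < L / 2
    · have h2 : (a + 1).val = a.val + 1 := by rw [val_add_one_eq hL, if_neg (by omega)]
      refine ⟨(a + 1, b), ?_, ?_⟩
      · rw [vertex_ne_zero_iff]; simp [h2]
      · simp only [treeEdge, h2]
        rw [if_neg (by omega), if_pos (by omega), add_sub_cancel_right]
    · refine ⟨(a, b), ?_, ?_⟩
      · rw [vertex_ne_zero_iff]; dsimp only; omega
      · simp only [treeEdge]
        rw [if_neg (by omega), if_neg (by omega)]

lemma mem_toricTree_true (hL : 2 ≤ L) {a b : ZMod L} :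
    (a, b, true) ∈ toricTree L ↔ a = 0 ∧ b.val ≠ L / 2 := by
  simp only [toricTree, Finset.mem_image, Finset.mem_erase, Finset.mem_univ, and_true]
  have h3 := b.val_lt
  constructor
  · rintro ⟨⟨x, y⟩, h0, h⟩
    have h1 := x.val_lt
    have h1 := y.val_lt
    simp only [vertex_ne_zero_iff] at h0
    simp only [treeEdge] at h
    split_ifs at h <;>
    simp only [Prod.ext_iff, val_ext L, val_sub_one_eq hL,
      Bool.false_eq_true, and_false, and_true, ZMod.val_zero] at h ⊢ <;>
    grind
  · rintro ⟨rfl, h⟩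
    by_cases h1 : b.val < L / 2
    · have h2 : (b + 1).val = b.val + 1 := by rw [val_add_one_eq hL, if_neg (by omega)]
      refine ⟨(0, b + 1), ?_, ?_⟩
      · rw [vertex_ne_zero_iff]; simp [h2]
      · simp only [treeEdge, h2]
        rw [if_pos (by simp), if_pos (by omega), add_sub_cancel_right]
    · refine ⟨(0, b), ?_, ?_⟩
      · rw [vertex_ne_zero_iff]; dsimp only; omega
      · simp only [treeEdge]
        rw [if_pos (by simp), if_neg (by omega)]

omit [NeZero L] in
/-- Each edge lies in the stars of its two end points. -/
lemma ind_vertexStar_false (hL : 2 ≤ L) (u : ZMod L × ZMod L) (a b : ZMod L) :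
    ind (vertexStar u.1 u.2) (a, b, false) =
      (if u = (a, b) then 1 else 0) + if u = (a + 1, b) then 1 else 0 := by
  obtain ⟨x, y⟩ := u
  have : a ≠ a + 1 := by
    have : Fact (1 < L) := ⟨hL⟩
    simp
  simp only [ind, mem_vertexStar_false, Prod.mk.injEq, eq_sub_iff_add_eq]
  grind

omit [NeZero L] in
lemma ind_vertexStar_true (hL : 2 ≤ L) (u : ZMod L × ZMod L) (a b : ZMod L) :
    ind (vertexStar u.1 u.2) (a, b, true) =
      (if u = (a, b) then 1 else 0) + if u = (a, b + 1) then 1 else 0 := by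
  obtain ⟨x, y⟩ := u
  have : b ≠ b + 1 := by
    have : Fact (1 < L) := ⟨hL⟩
    simp
  simp only [ind, mem_vertexStar_true, Prod.mk.injEq, eq_sub_iff_add_eq]
  grind

/-- The product of all the stars is the identity. -/
lemma sum_ind_vertexStar (hL : 2 ≤ L) (q : TQubit L) :
    ∑ u : ZMod L × ZMod L, ind (vertexStar u.1 u.2) q = 0 := by
  obtain ⟨a, b, s⟩ := q
  cases s
  · simp only [ind_vertexStar_false hL, Finset.sum_add_distrib, Finset.sum_ite_eq',
      Finset.mem_univ, if_true]
    decide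
  · simp only [ind_vertexStar_true hL, Finset.sum_add_distrib, Finset.sum_ite_eq',
      Finset.mem_univ, if_true]
    decide

lemma sum_ind_comm {Q : Type} [DecidableEq Q] (S P : Finset Q) :
    ∑ q ∈ S, ind P q = ∑ q ∈ P, ind S q := by
  simp only [ind, Finset.sum_ite_mem, Finset.inter_comm]

omit [NeZero L] in
/-- A star and a plaquette overlap in an even number of edges. -/
lemma sum_vertexStar_ind_plaquette (hL : 2 ≤ L) (u p : ZMod L × ZMod L) :
    ∑ q ∈ vertexStar u.1 u.2, ind (plaquette p.1 p.2) q = 0 := by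
  have : Fact (1 < L) := ⟨hL⟩
  obtain ⟨x, y⟩ := p
  rw [sum_ind_comm, plaquette, Finset.sum_insert (by simp), Finset.sum_insert (by simp),
    Finset.sum_insert (by simp), Finset.sum_singleton, ind_vertexStar_false hL,
    ind_vertexStar_false hL, ind_vertexStar_true hL, ind_vertexStar_true hL]
  generalize (if u = (x, y) then (1 : ZMod 2) else 0) = c1
  generalize (if u = (x + 1, y) then (1 : ZMod 2) else 0) = c2
  generalize (if u = (x, y + 1) then (1 : ZMod 2) else 0) = c3
  generalize (if u = (x + 1, y + 1) then (1 : ZMod 2) else 0) = c4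
  have h2 : (2 : ZMod 2) = 0 := rfl
  linear_combination (c1 + c2 + c3 + c4) * h2

end ToricTree

/-! ### The loop of plaquettes -/

section ToricLoop

variable {L : ℕ} [NeZero L]

/-- The vertices, numbered row by row. -/
def vertexAt (L : ℕ) (i : Fin (L ^ 2)) : ZMod L × ZMod L :=
  (((i.val % L : ℕ) : ZMod L), ((i.val / L : ℕ) : ZMod L))

/-- The successor of `u` in the cyclic row by row order of the vertices. -/
def nextVertex (u : ZMod L × ZMod L) : ZMod L × ZMod L :=
  if u.1.val + 1 = L then (0, u.2 + 1) else (u.1 + 1, u.2)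

lemma vertexAt_val (i : Fin (L ^ 2)) :
    (vertexAt L i).1.val = i.val % L ∧ (vertexAt L i).2.val = i.val / L := by
  have hi := i.isLt
  have hL : 0 < L := Nat.pos_of_ne_zero (NeZero.ne L)
  exact ⟨ZMod.val_cast_of_lt (Nat.mod_lt _ hL),
    ZMod.val_cast_of_lt (Nat.div_lt_of_lt_mul (hi.trans_eq (sq L)))⟩

lemma vertexAt_bijective : Function.Bijective (vertexAt L) := by
  rw [Fintype.bijective_iff_injective_and_card]
  constructor
  · intro i j h
    obtain ⟨h1, h2⟩ := vertexAt_val i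
    obtain ⟨h3, h4⟩ := vertexAt_val j
    rw [h] at h1 h2
    refine Fin.ext ?_
    rw [← Nat.div_add_mod i.val L, ← Nat.div_add_mod j.val L, ← h1, ← h2, ← h3, ← h4]
  · simp [ZMod.card, sq]

lemma vertexAt_finRotate (hL : 2 ≤ L) (i : Fin (L ^ 2)) :
    vertexAt L (finRotate (L ^ 2) i) = nextVertex (vertexAt L i) := by
  obtain ⟨h1, h2⟩ := vertexAt_val i
  obtain ⟨h3, h4⟩ := vertexAt_val (finRotate (L ^ 2) i)
  rw [val_finRotate] at h3 h4
  have hi := i.isLt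
  have e := Nat.div_add_mod i.val L
  have hm := Nat.mod_lt i.val (show 0 < L by omega)
  have hd : i.val / L < L := Nat.div_lt_of_lt_mul (by rw [← sq]; exact hi)
  set x := i.val % L
  set y := i.val / L
  have hlast : i.val + 1 = L ^ 2 ↔ x + 1 = L ∧ y + 1 = L := by
    constructor
    · intro h
      have hy : y + 1 = L := by
        by_contra hne
        have : L * y + L ≤ L * L - L := by
          have : y + 1 ≤ L - 1 := by omega
          calc L * y + L = L * (y + 1) := by ring
            _ ≤ L * (L - 1) := Nat.mul_le_mul_left _ this
            _ = L * L - L := by rw [Nat.mul_sub, mul_one]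
        have : L ≤ L * L := Nat.le_mul_self L
        have : L ^ 2 = L * L := sq L
        omega
      refine ⟨?_, hy⟩
      have : L ^ 2 = L * y + L := by rw [sq]; nth_rw 2 [← hy]; ring
      omega
    · rintro ⟨hx, hy⟩
      have : L ^ 2 = L * y + L := by rw [sq]; nth_rw 2 [← hy]; ring
      omega
  have hdiv : ∀ a b, b < L → (L * a + b) / L = a ∧ (L * a + b) % L = b := fun a b hb =>
    ⟨by rw [Nat.mul_add_div (by omega), Nat.div_eq_of_lt hb, add_zero],
     by rw [Nat.mul_add_mod, Nat.mod_eq_of_lt hb]⟩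
  rw [nextVertex, h1]
  by_cases hx : x + 1 = L
  · rw [if_pos hx]
    refine Prod.ext ?_ ?_
    · rw [val_ext L, h3]
      dsimp only
      rw [ZMod.val_zero]
      split_ifs with hl
      · simp
      · rw [← e, show L * y + x + 1 = L * (y + 1) + 0 by rw [mul_add]; omega]
        exact (hdiv _ _ (by omega)).2
    · rw [val_ext L, h4]
      dsimp only
      rw [val_add_one_eq hL, h2]
      split_ifs with hl hl' hl'
      · simp
      · omega
      · omega
      · rw [← e, show L * y + x + 1 = L * (y + 1) + 0 by rw [mul_add]; omega]
        exact (hdiv _ _ (by omega)).1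
  · have hl : i.val + 1 ≠ L ^ 2 := by omega
    rw [if_neg hl] at h3 h4
    rw [if_neg hx]
    refine Prod.ext ?_ ?_
    · rw [val_ext L, h3]
      dsimp only
      rw [val_add_one_eq hL, h1, if_neg hx, ← e, add_assoc]
      exact (hdiv _ _ (by omega)).2
    · rw [val_ext L, h4]
      dsimp only
      rw [h2, ← e, add_assoc]
      exact (hdiv _ _ (by omega)).1

/-- The position at which the rows are cut by the spanning tree. -/
def rowLink (L : ℕ) [NeZero L] : ZMod L := ((L / 2 : ℕ) : ZMod L)

lemma val_rowLink (hL : 2 ≤ L) : (rowLink L).val = L / 2 := ZMod.val_cast_of_lt (by omega)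

/-- The qubit of the loop between the plaquette at `u` and its predecessor in the row by row order.
Within a row it is the edge that separates the two plaquettes, and between consecutive rows it is
the horizontal edge outside the tree. -/
def loopQubit (u : ZMod L × ZMod L) : TQubit L :=
  if u.1.val = 0 then (rowLink L, u.2, false) else (u.1, u.2, true)

/-- The loop is completed within one layer from the vertical edges outside column `0`, which form a
path of plaquettes in each row. The horizontal edge `q` outside the tree joins two plaquettes of
consecutive rows at position `L / 2`, and the vertical edges from there to the end of the lower
row and from the start of the upper row extend it to a link between the end and the start. The
remaining vertical edge of column `0` outside the tree is cancelled by the others of its row. -/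
def loopParents (q : TQubit L) : Finset (TQubit L) :=
  Finset.univ.filter fun t => t.2.2 = true ∧ t.1.val ≠ 0 ∧
    ((q.2.2 = false ∧ q.1.val = L / 2 ∧
        ((L / 2 < t.1.val ∧ t.2.1 + 1 = q.2.1) ∨ (t.1.val ≤ L / 2 ∧ t.2.1 = q.2.1))) ∨
      (q.2.2 = true ∧ q.1.val = 0 ∧ q.2.1.val = L / 2 ∧ t.2.1 = q.2.1))

/-- The vertical edges outside column `0` are the targets of the layer. The other qubits may be
controls. -/
def loopRank (q : TQubit L) : ℕ := if q.2.2 = true ∧ q.1.val ≠ 0 then 0 else 1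

lemma loopRank_lt (q t : TQubit L) (h : t ∈ loopParents q) : loopRank t < loopRank q := by
  simp only [loopParents, Finset.mem_filter, Finset.mem_univ, true_and] at h
  simp only [loopRank]
  obtain ⟨h1, h2, h3⟩ := h
  rw [if_pos ⟨h1, h2⟩, if_neg]
  · exact zero_lt_one
  · rintro ⟨h4, h5⟩
    rcases h3 with h3 | h3
    · simp [h3.1] at h4
    · exact h5 h3.2.1

lemma loopQubit_injective : Function.Injective (loopQubit (L := L)) := by
  rintro ⟨x, y⟩ ⟨x', y'⟩ h
  simp only [loopQubit] at h
  simp only [Prod.mk.injEq, val_ext L]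
  split_ifs at h <;> simp only [Prod.mk.injEq, val_ext L] at h <;> simp_all

lemma nextVertex_ne (hL : 2 ≤ L) (u : ZMod L × ZMod L) : u ≠ nextVertex u := by
  obtain ⟨x, y⟩ := u
  intro h
  have hx := x.val_lt
  simp only [nextVertex] at h
  split_ifs at h <;>
    simp only [Prod.mk.injEq, val_ext L, val_add_one_eq hL, ZMod.val_zero] at h <;> grind

lemma notMem_loopParents_false (a b : ZMod L) (q : TQubit L) : (a, b, false) ∉ loopParents q := by
  simp [loopParents]

lemma mem_loopParents_false {x y a b : ZMod L} :
    (x, y, true) ∈ loopParents (a, b, false) ↔ x.val ≠ 0 ∧ a.val = L / 2 ∧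
      ((L / 2 < x.val ∧ y + 1 = b) ∨ (x.val ≤ L / 2 ∧ y = b)) := by
  simp [loopParents]

lemma mem_loopParents_true {x y a b : ZMod L} :
    (x, y, true) ∈ loopParents (a, b, true) ↔
      x.val ≠ 0 ∧ a.val = 0 ∧ b.val = L / 2 ∧ y = b := by
  simp [loopParents]

/-- The plaquette operator outside the tree, in terms of the two loop qubits that it ends on. -/
lemma ind_plaquette_sdiff (hL : 2 ≤ L) (u : ZMod L × ZMod L) (q : TQubit L) :
    ind (plaquette u.1 u.2 \ toricTree L) q =
      ind {loopQubit u, loopQubit (nextVertex u)} q +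
        ∑ t ∈ loopParents q, ind {loopQubit u, loopQubit (nextVertex u)} t := by
  have hne := loopQubit_injective.ne (nextVertex_ne hL u)
  have hsum : ∑ t ∈ loopParents q, ind {loopQubit u, loopQubit (nextVertex u)} t =
      (if loopQubit u ∈ loopParents q then 1 else 0) +
        if loopQubit (nextVertex u) ∈ loopParents q then 1 else 0 := by
    simp only [ind_pair hne, Finset.sum_add_distrib, Finset.sum_ite_eq']
  rw [hsum, ind_pair hne]
  obtain ⟨x, y⟩ := u
  obtain ⟨a, b, s⟩ := q
  have h1 := x.val_lt
  have h3 := a.val_lt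
  have hr := val_rowLink hL
  have hx1 := val_add_one_eq hL x
  have hy : y ≠ y + 1 := by
    have : Fact (1 < L) := ⟨hL⟩
    simp
  have hB : loopQubit (x, y) = if x.val = 0 then (rowLink L, y, false) else (x, y, true) := rfl
  have hB' : loopQubit (nextVertex (x, y)) =
      if x.val + 1 = L then (rowLink L, y + 1, false) else (x + 1, y, true) := by
    simp only [nextVertex]
    split_ifs with h
    · simp [loopQubit]
    · rw [if_neg h] at hx1
      simp [loopQubit, hx1]
  simp only [ind, Finset.mem_sdiff]
  by_cases hx0 : x.val = 0 <;> by_cases hxl : x.val + 1 = L <;>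
    simp only [hxl, if_true, if_false] at hB' hx1 <;>
    simp only [hx0, if_true, if_false] at hB <;>
    rw [hB, hB'] <;>
    cases s <;>
    simp only [mem_plaquette_false, mem_plaquette_true, mem_toricTree_false hL,
      mem_toricTree_true hL, notMem_loopParents_false, mem_loopParents_false,
      mem_loopParents_true, Prod.mk.injEq, and_true, Bool.true_eq_false, Bool.false_eq_true,
      and_false, hx1, val_ext L (x := a), hr, ZMod.val_zero, eq_comm (a := y + 1),
      eq_comm (a := y), if_false] <;>
    by_cases hb : b = y <;> by_cases hb' : b = y + 1 <;>
    first
    | exact absurd (hb.symm.trans hb') hy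
    | (simp only [hb, hb', if_false, and_true, and_false, or_true, or_false,
        false_or, false_and, true_and, hy, hy.symm]
       try split_ifs
       all_goals first | decide | omega)

end ToricLoop

/-! ### Hamiltonians of one kind -/

section Pure

variable {Q : Type} [Fintype Q] [DecidableEq Q]

omit [Fintype Q] [DecidableEq Q] in
lemma isPure_neg_sum {P : Finset Q → Op Q} {q : Finset Q} {ι : Type*} (s : Finset ι)
    (T : ι → Finset Q) (hT : ∀ i ∈ s, T i ⊆ q) : IsPure P q (-∑ i ∈ s, P (T i)) := by
  refine ⟨s.val.map T, ?_, ?_⟩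
  · intro S hS
    obtain ⟨i, hi, rfl⟩ := Multiset.mem_map.1 hS
    exact hT i hi
  · rw [Multiset.map_map]; rfl

omit [Fintype Q] [DecidableEq Q] in
lemma isPure_field (P : Finset Q → Op Q) (q : Finset Q) : IsPure P q (field P q) :=
  isPure_neg_sum q (fun i => {i}) fun _ hi => Finset.singleton_subset_iff.2 hi

omit [Fintype Q] [DecidableEq Q] in
lemma isPure_parityCheck (P : Finset Q → Op Q) (q : Finset Q) : IsPure P q (parityCheck P q) := by
  refine ⟨q ::ₘ q.val.map fun i => {i}, ?_, ?_⟩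
  · intro S hS
    rcases Multiset.mem_cons.1 hS with rfl | hS
    · exact subset_rfl
    · obtain ⟨i, hi, rfl⟩ := Multiset.mem_map.1 hS
      exact Finset.singleton_subset_iff.2 hi
  · rw [Multiset.map_cons, Multiset.sum_cons, Multiset.map_map, neg_add_rev, parityCheck,
      sub_eq_add_neg]
    rfl

end Pure

/-! ### Decoupling of the toric code -/

section ToricTheorem

variable {L : ℕ} [NeZero L]

/-- All stars but the one at the root are turned into single qubits; the star at the root, which is
their product, becomes the global term. -/
theorem exists_toric_decoupling (hL : 2 ≤ L) :
    ∃ U : List (List (TQubit L × TQubit L)), IsCircuit toricNear U ∧ U.length ≤ L ∧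
      conj U (toricH L) = parityCheck pauliX (toricTree L) +
        -∑ u : ZMod L × ZMod L, pauliZ (plaquette u.1 u.2 \ toricTree L) := by
  obtain ⟨U, hU, hlen, hX, hR, hZ⟩ := exists_forest_circuit
    (cells := Finset.univ.erase (0 : ZMod L × ZMod L)) (S := fun u => vertexStar u.1 u.2)
    (te := treeEdge) (r := toricRank) (D := 2 * (L / 2)) (near := toricNear)
    (treeEdge_injOn hL) (fun u _ => treeEdge_mem u)
    (fun u hu q hq hne => toricRank_treeEdge_lt hL (Finset.ne_of_mem_erase hu) hq hne)
    toricRank_le (fun u _ p hp q hq => ⟨u.1, u.2, hp, hq⟩)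
  refine ⟨U, hU, by omega, ?_⟩
  have h0 : conj U (pauliX (vertexStar (0 : ZMod L × ZMod L).1 (0 : ZMod L × ZMod L).2)) =
      pauliX (toricTree L) := by
    refine hR _ fun q => ?_
    have h := sum_ind_vertexStar hL q
    rw [← Finset.add_sum_erase _ _ (Finset.mem_univ (0 : ZMod L × ZMod L))] at h
    exact CharTwo.add_eq_zero.1 h
  have hZ' : ∀ u : ZMod L × ZMod L, conj U (pauliZ (plaquette u.1 u.2)) =
      pauliZ (plaquette u.1 u.2 \ toricTree L) := fun u =>
    hZ _ fun v _ => sum_vertexStar_ind_plaquette hL v u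
  have hH : toricH L = -∑ u : ZMod L × ZMod L, pauliX (vertexStar u.1 u.2) -
      ∑ u : ZMod L × ZMod L, pauliZ (plaquette u.1 u.2) := by
    simp only [toricH, Fintype.sum_prod_type]
  rw [hH, conj_sub, conj_neg, conj_sum, conj_sum,
    ← Finset.add_sum_erase _ _ (Finset.mem_univ (0 : ZMod L × ZMod L)), h0,
    Finset.sum_congr rfl hX, Finset.sum_congr rfl fun u _ => hZ' u, parityCheck]
  have hs : ∑ i ∈ toricTree L, pauliX {i} =
      ∑ u ∈ Finset.univ.erase (0 : ZMod L × ZMod L), pauliX {treeEdge u} :=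
    Finset.sum_image (treeEdge_injOn hL)
  rw [hs]
  abel

/-- The tree edges in the order of their vertices. The root gets the edge of column `0` outside the
tree, the one qubit that occurs neither in the tree nor in the loop of the plaquettes. -/
def treeLoopQubit (i : Fin (L ^ 2)) : TQubit L :=
  if i.val = 0 then (0, rowLink L, true) else treeEdge (vertexAt L i)

lemma vertexAt_ne_zero {i : Fin (L ^ 2)} : vertexAt L i ≠ 0 ↔ i.val ≠ 0 := by
  obtain ⟨h1, h2⟩ := vertexAt_val i
  rw [vertex_ne_zero_iff, h1, h2]
  have e := Nat.div_add_mod i.val L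
  constructor
  · intro h h0
    simp [h0] at h
  · intro h
    by_contra! hc
    rw [hc.1, hc.2] at e
    omega

lemma toricTree_eq_image :
    toricTree L = (Finset.univ.filter fun i : Fin (L ^ 2) => i.val ≠ 0).image treeLoopQubit := by
  ext q
  simp only [toricTree, Finset.mem_image, Finset.mem_erase, Finset.mem_univ, and_true,
    Finset.mem_filter, true_and]
  constructor
  · rintro ⟨u, hu, rfl⟩
    obtain ⟨i, rfl⟩ := vertexAt_bijective.2 u
    exact ⟨i, vertexAt_ne_zero.1 hu, if_neg (vertexAt_ne_zero.1 hu)⟩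
  · rintro ⟨i, hi, rfl⟩
    exact ⟨vertexAt L i, vertexAt_ne_zero.2 hi, (if_neg hi).symm⟩

lemma rowLink_notMem_toricTree (hL : 2 ≤ L) : ((0, rowLink L, true) : TQubit L) ∉ toricTree L := by
  rw [mem_toricTree_true hL, val_rowLink hL]
  simp

lemma treeLoopQubit_mem {i : Fin (L ^ 2)} (hi : i.val ≠ 0) : treeLoopQubit i ∈ toricTree L := by
  rw [toricTree_eq_image]
  exact Finset.mem_image_of_mem _ (by simpa using hi)

lemma treeLoopQubit_injective (hL : 2 ≤ L) :
    Function.Injective (treeLoopQubit : Fin (L ^ 2) → TQubit L) := by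
  have key : ∀ i j : Fin (L ^ 2), i.val = 0 → treeLoopQubit i = treeLoopQubit j → j.val = 0 := by
    intro i j hi h
    by_contra hj
    have := treeLoopQubit_mem hj
    rw [← h, treeLoopQubit, if_pos hi] at this
    exact rowLink_notMem_toricTree hL this
  intro i j h
  by_cases hi : i.val = 0
  · exact Fin.ext (hi.trans (key i j hi h).symm)
  · by_cases hj : j.val = 0
    · exact absurd (key j i hj h.symm) hi
    · rw [treeLoopQubit, treeLoopQubit, if_neg hi, if_neg hj] at h
      exact vertexAt_bijective.1 (treeEdge_injOn hL (by simpa using vertexAt_ne_zero.2 hi)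
        (by simpa using vertexAt_ne_zero.2 hj) h)

lemma loopQubit_notMem_toricTree (hL : 2 ≤ L) (u : ZMod L × ZMod L) :
    loopQubit u ∉ toricTree L := by
  rw [loopQubit]
  split_ifs with h
  · rw [mem_toricTree_false hL, val_rowLink hL]
    simp
  · rw [mem_toricTree_true hL, val_ext L, ZMod.val_zero]
    exact fun h' => h h'.1

lemma loopQubit_ne_treeLoopQubit (hL : 2 ≤ L) (i : Fin (L ^ 2)) (u : ZMod L × ZMod L) :
    treeLoopQubit i ≠ loopQubit u := by
  intro h
  by_cases hi : i.val = 0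
  · rw [treeLoopQubit, if_pos hi, loopQubit] at h
    split_ifs at h with hu
    · simp at h
    · simp only [Prod.mk.injEq] at h
      rw [← h.1] at hu
      simp at hu
  · exact loopQubit_notMem_toricTree hL u (h ▸ treeLoopQubit_mem hi)

theorem exists_plaquette_loop_layer (hL : 2 ≤ L) :
    ∃ VZ : List (TQubit L × TQubit L),
      IsLayer (fun c t => c ∈ (toricTree L)ᶜ ∧ t ∈ (toricTree L)ᶜ) VZ ∧
      conj [VZ] (-∑ u : ZMod L × ZMod L, pauliZ (plaquette u.1 u.2 \ toricTree L)) =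
        isingLoop pauliZ fun i => loopQubit (vertexAt L i) := by
  have hr : ∀ q : TQubit L, ∀ t ∈ loopParents q, loopRank t < loopRank q := loopRank_lt
  have hD : ∀ q : TQubit L, loopRank q ≤ 1 := fun q => by
    rw [loopRank]; split_ifs <;> simp
  have hC : IsCircuit (fun c t => c ∈ (toricTree L)ᶜ ∧ t ∈ (toricTree L)ᶜ)
      (reverseGates (rankCircuit loopParents loopRank 1)) := by
    refine IsCircuit.reverseGates (isCircuit_rankCircuit hr ?_ 1)
    rintro ⟨a, b, s⟩ ⟨x, y, s'⟩ h
    cases s'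
    · exact absurd h (notMem_loopParents_false _ _ _)
    · cases s
      · obtain ⟨h1, h2, -⟩ := mem_loopParents_false.1 h
        simp only [Finset.mem_compl, mem_toricTree_false hL, mem_toricTree_true hL]
        refine ⟨by simp [h2], fun h => h1 (by simp [h.1])⟩
      · obtain ⟨h1, -, h3, -⟩ := mem_loopParents_true.1 h
        simp only [Finset.mem_compl, mem_toricTree_true hL]
        exact ⟨fun h => h.2 h3, fun h => h1 (by simp [h.1])⟩
  refine ⟨(rankLayer loopParents loopRank 1).map Prod.swap, ?_, ?_⟩
  · exact hC _ (by simp [reverseGates, rankCircuit])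
  · have h1 : [(rankLayer (loopParents (L := L)) loopRank 1).map Prod.swap] =
        reverseGates (rankCircuit loopParents loopRank 1) := by
      simp [reverseGates, rankCircuit]
    rw [h1, conj_neg, conj_sum, isingLoop]
    congr 1
    rw [← Function.Bijective.sum_comp (vertexAt_bijective (L := L))]
    refine Finset.sum_congr rfl fun i _ => ?_
    rw [vertexAt_finRotate hL]
    exact conj_reverseGates_pauliZ hr hD (ind_plaquette_sdiff hL _)

end ToricTheorem

/-! ### Decoupling of the rotated surface code -/

section RotatedTree

variable {L : ℕ}

/-- The upper right corners of the squares of type `X` in the rotated surface code. -/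
def xCells (L : ℕ) : Finset (ℕ × ℕ) :=
  (Finset.range (L + 2) ×ˢ Finset.Icc 1 L).filter fun u => Even (u.1 + u.2)

/-- The lattice point `(x, y)`, with both coordinates truncated to `[0, L]`. -/
def point (L x y : ℕ) : RQubit L := (⟨min x L, by omega⟩, ⟨min y L, by omega⟩)

/-- The qubit assigned to an `X` cell: the corner in an even column (or in the last column, when `L`
is odd and the cell sticks out on the right), on the lower side for a cell in the lower half of
the lattice and on the upper side for one in the upper half. So the middle row is not assigned. -/
def treePoint (L : ℕ) (u : ℕ × ℕ) : RQubit L :=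
  point L (2 * (u.1 / 2)) (if u.2 ≤ L / 2 then u.2 - 1 else u.2)

/-- The coordinates of the qubits that are assigned to an `X` cell. -/
def IsTreePoint (L x y : ℕ) : Prop :=
  (y < L / 2 ∧ (x % 2 = 0 ∨ (x = L ∧ y % 2 = 1))) ∨
    (L / 2 < y ∧ (x % 2 = 0 ∨ (x = L ∧ y % 2 = 0)))

instance (L x y : ℕ) : Decidable (IsTreePoint L x y) := by
  unfold IsTreePoint; infer_instance

/-- The distance of an assigned qubit from the lower or upper side. The other qubits come last. -/
def rotatedRank (q : RQubit L) : ℕ :=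
  if IsTreePoint L q.1.val q.2.val then
    if q.2.val < L / 2 then q.2.val else L - q.2.val
  else L - L / 2

/-- The qubits that are assigned to an `X` cell. -/
def rotatedTree (L : ℕ) : Finset (RQubit L) := (xCells L).image (treePoint L)

lemma mem_xCells {u : ℕ × ℕ} :
    u ∈ xCells L ↔ u.1 ≤ L + 1 ∧ 1 ≤ u.2 ∧ u.2 ≤ L ∧ (u.1 + u.2) % 2 = 0 := by
  simp only [xCells, Finset.mem_filter, Finset.mem_product, Finset.mem_range, Finset.mem_Icc,
    Nat.even_iff]
  omega

lemma mem_cell {a b : ℕ} {q : RQubit L} :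
    q ∈ cell a b ↔ (q.1.val = a ∨ q.1.val + 1 = a) ∧ (q.2.val = b ∨ q.2.val + 1 = b) := by
  simp [cell]

lemma point_eq_iff {x y : ℕ} {q : RQubit L} :
    q = point L x y ↔ q.1.val = min x L ∧ q.2.val = min y L := by
  rw [Prod.ext_iff, Fin.ext_iff, Fin.ext_iff]
  rfl

lemma mem_rotatedTree {q : RQubit L} : q ∈ rotatedTree L ↔ IsTreePoint L q.1.val q.2.val := by
  have h1 := q.1.isLt
  have h2 := q.2.isLt
  simp only [rotatedTree, Finset.mem_image, IsTreePoint]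
  constructor
  · rintro ⟨u, hu, h⟩
    rw [mem_xCells] at hu
    rw [eq_comm, treePoint, point_eq_iff] at h
    split_ifs at h <;> omega
  · intro h
    set b := if q.2.val < L / 2 then q.2.val + 1 else q.2.val with hb
    refine ⟨(if (q.1.val + b) % 2 = 0 then q.1.val else q.1.val + 1, b), ?_, ?_⟩
    · rw [mem_xCells]
      dsimp only
      split_ifs at hb ⊢ <;> omega
    · rw [eq_comm, treePoint, point_eq_iff]
      dsimp only
      split_ifs at hb ⊢ <;> omega

lemma rotatedRank_le (q : RQubit L) : rotatedRank q ≤ L - L / 2 := by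
  have := q.2.isLt
  rw [rotatedRank]
  split_ifs with h <;> first | rw [IsTreePoint] at h; omega | omega

lemma treePoint_mem {u : ℕ × ℕ} (hu : u ∈ xCells L) : treePoint L u ∈ cell u.1 u.2 := by
  rw [mem_xCells] at hu
  rw [mem_cell, treePoint, point]
  dsimp only
  split_ifs <;> omega

lemma treePoint_injOn : Set.InjOn (treePoint L) (xCells L) := by
  intro u hu v hv h
  rw [Finset.mem_coe, mem_xCells] at hu hv
  rw [treePoint, treePoint, point_eq_iff, point] at h
  dsimp only at h
  rw [Prod.ext_iff]
  split_ifs at h <;> omega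

lemma rotatedRank_treePoint_lt {u : ℕ × ℕ} (hu : u ∈ xCells L) {q : RQubit L}
    (hq : q ∈ cell u.1 u.2) (hne : q ≠ treePoint L u) :
    rotatedRank (treePoint L u) < rotatedRank q := by
  have h1 := q.1.isLt
  have h2 := q.2.isLt
  have h3 : IsTreePoint L (treePoint L u).1.val (treePoint L u).2.val :=
    mem_rotatedTree.1 (Finset.mem_image_of_mem _ hu)
  rw [mem_xCells] at hu
  rw [mem_cell] at hq
  rw [treePoint, ne_eq, point_eq_iff] at hne
  rw [rotatedRank, rotatedRank, if_pos h3]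
  by_cases h4 : IsTreePoint L q.1.val q.2.val
  · rw [if_pos h4]
    rw [IsTreePoint] at h4
    simp only [treePoint, point]
    split_ifs at hne ⊢ <;> omega
  · rw [if_neg h4]
    simp only [treePoint, point]
    split_ifs at hne ⊢ <;> omega

lemma sum_interval {a : ℕ} (h1 : 1 ≤ a) (h2 : a ≤ L) :
    ∑ x : Fin (L + 1), (if x.val = a ∨ x.val + 1 = a then (1 : ZMod 2) else 0) = 0 := by
  rw [Fin.sum_univ_eq_sum_range fun x => if x = a ∨ x + 1 = a then (1 : ZMod 2) else 0,
    ← Finset.sum_filter]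
  have : (Finset.range (L + 1)).filter (fun x => x = a ∨ x + 1 = a) = {a - 1, a} := by
    ext x
    simp only [Finset.mem_filter, Finset.mem_range, Finset.mem_insert, Finset.mem_singleton]
    omega
  rw [this, Finset.sum_pair (by omega)]
  decide

/-- An `X` cell and a `Z` cell overlap in an even number of points. -/
lemma sum_cell_ind_cell {a b a' b' : ℕ} (hb : 1 ≤ b ∧ b ≤ L) (ha' : 1 ≤ a' ∧ a' ≤ L)
    (hpar : (a + b) % 2 = 0) (hpar' : (a' + b') % 2 = 1) :
    ∑ q ∈ (cell a b : Finset (RQubit L)), ind (cell a' b') q = 0 := by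
  have h : ∀ q : RQubit L, (if q ∈ (cell a b : Finset (RQubit L)) then ind (cell a' b') q else 0) =
      (if (q.1.val = a ∨ q.1.val + 1 = a) ∧ (q.1.val = a' ∨ q.1.val + 1 = a') then 1 else 0) *
      (if (q.2.val = b ∨ q.2.val + 1 = b) ∧ (q.2.val = b' ∨ q.2.val + 1 = b') then 1 else 0) := by
    intro q
    simp only [ind, mem_cell]
    rw [← ite_and, ite_zero_mul_ite_zero, mul_one]
    refine if_congr ?_ rfl rfl
    tauto
  rw [← Finset.univ_inter (cell a b), ← Finset.sum_ite_mem, Finset.sum_congr rfl fun q _ => h q,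
    Fintype.sum_prod_type]
  dsimp only
  rw [← Fintype.sum_mul_sum
    (fun x : Fin (L + 1) =>
      if (x.val = a ∨ x.val + 1 = a) ∧ (x.val = a' ∨ x.val + 1 = a') then (1 : ZMod 2) else 0)
    (fun y : Fin (L + 1) =>
      if (y.val = b ∨ y.val + 1 = b) ∧ (y.val = b' ∨ y.val + 1 = b') then (1 : ZMod 2) else 0)]
  by_cases e1 : a = a'
  · subst e1
    simp only [and_self]
    rw [sum_interval ha'.1 ha'.2, zero_mul]
  · by_cases e2 : b = b'
    · subst e2
      simp only [and_self]
      rw [sum_interval hb.1 hb.2, mul_zero]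
    · by_cases e3 : (a + a') % 2 = 0
      · rw [Finset.sum_eq_zero, zero_mul]
        intro x _
        rw [if_neg (by omega)]
      · rw [mul_comm, Finset.sum_eq_zero, zero_mul]
        intro x _
        rw [if_neg (by omega)]

/-- The upper right corners of the squares of type `Z` in the rotated surface code. -/
def zCells (L : ℕ) : Finset (ℕ × ℕ) :=
  (Finset.Icc 1 L ×ˢ Finset.range (L + 2)).filter fun u => Odd (u.1 + u.2)

lemma mem_zCells {u : ℕ × ℕ} :
    u ∈ zCells L ↔ (1 ≤ u.1 ∧ u.1 ≤ L) ∧ u.2 ≤ L + 1 ∧ (u.1 + u.2) % 2 = 1 := by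
  simp only [zCells, Finset.mem_filter, Finset.mem_product, Finset.mem_range, Finset.mem_Icc,
    Nat.odd_iff]
  omega

lemma rotatedH_eq (L : ℕ) : rotatedH L = -∑ u ∈ xCells L, pauliX (cell u.1 u.2) -
    ∑ u ∈ zCells L, pauliZ (cell u.1 u.2) := by
  simp only [rotatedH, xCells, zCells, Finset.sum_filter, Finset.sum_product]

/-- The assigned qubits carry the uniform field. The `Z` cells are left with their other qubits. -/
theorem exists_rotated_decoupling (L : ℕ) :
    ∃ U : List (List (RQubit L × RQubit L)), IsCircuit rotatedNear U ∧ U.length = L - L / 2 ∧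
      conj U (rotatedH L) = field pauliX (rotatedTree L) +
        -∑ u ∈ zCells L, pauliZ (cell u.1 u.2 \ rotatedTree L) := by
  obtain ⟨U, hU, hlen, hX, -, hZ⟩ := exists_forest_circuit
    (cells := xCells L) (S := fun u => (cell u.1 u.2 : Finset (RQubit L)))
    (te := treePoint L) (r := rotatedRank) (D := L - L / 2) (near := rotatedNear)
    treePoint_injOn (fun u => treePoint_mem) (fun u hu q => rotatedRank_treePoint_lt hu)
    rotatedRank_le (fun u _ p hp q hq => by
      rw [mem_cell] at hp hq
      rw [rotatedNear]
      omega)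
  refine ⟨U, hU, hlen, ?_⟩
  have hs : ∑ i ∈ rotatedTree L, pauliX {i} = ∑ u ∈ xCells L, pauliX {treePoint L u} :=
    Finset.sum_image treePoint_injOn
  rw [rotatedH_eq, conj_sub, conj_neg, conj_sum, conj_sum, Finset.sum_congr rfl hX, field, hs,
    sub_eq_add_neg]
  congr 2
  refine Finset.sum_congr rfl fun u hu => hZ _ fun v hv => ?_
  rw [mem_zCells] at hu
  rw [mem_xCells] at hv
  exact sum_cell_ind_cell ⟨hv.2.1, hv.2.2.1⟩ hu.1 hv.2.2.2 hu.2.2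

end RotatedTree

/-! ### Reduction of the middle row -/

section RotatedChains

variable {L : ℕ}

/-- The middle row is a path of `L` links, the link `a` joining the columns `a - 1` and `a`. This is
the end of the link that is farther from the centre, to which the second circuit reduces it. -/
def linkEnd (L a : ℕ) : ℕ := if a ≤ L / 2 then a - 1 else a

lemma linkEnd_cases (L a : ℕ) :
    (a ≤ L / 2 ∧ linkEnd L a = a - 1) ∨ (L / 2 < a ∧ linkEnd L a = a) := by
  rw [linkEnd]; split_ifs <;> omega

lemma linkEnd_le {a : ℕ} (ha : a ≤ L) : linkEnd L a ≤ L := by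
  rw [linkEnd]; split_ifs <;> omega

/-- In the middle row the parent of a qubit is its outer neighbour; the central qubit has both its
neighbours as parents. -/
def middleParents (q : RQubit L) : Finset (RQubit L) :=
  Finset.univ.filter fun t => t.2.val = L / 2 ∧ q.2.val = L / 2 ∧
    ((t.1.val + 1 = q.1.val ∧ q.1.val ≤ L / 2) ∨ (q.1.val + 1 = t.1.val ∧ L / 2 ≤ q.1.val))

/-- The distance from the nearer end of the middle row. -/
def middleRank (q : RQubit L) : ℕ :=
  if q.1.val < L / 2 then q.1.val else L - q.1.val

lemma middleRank_lt (q t : RQubit L) (h : t ∈ middleParents q) : middleRank t < middleRank q := by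
  simp only [middleParents, Finset.mem_filter, Finset.mem_univ, true_and] at h
  have := t.1.isLt
  simp only [middleRank]
  split_ifs <;> omega

lemma middleRank_le (q : RQubit L) : middleRank q ≤ L - L / 2 := by
  simp only [middleRank]
  split_ifs <;> omega

/-- The support of the `Z` operator of the cell `(a, b)` after both circuits. -/
def linkSupport (L a b : ℕ) : Finset (RQubit L) :=
  Finset.univ.filter fun q =>
    (q.2.val ≠ L / 2 ∧ q ∈ cell a b \ rotatedTree L) ∨
      (q.2.val = L / 2 ∧ (b = L / 2 ∨ b = L / 2 + 1) ∧ q.1.val = linkEnd L a)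

lemma ind_cell_sdiff {a b : ℕ} (ha : 1 ≤ a) (ha' : a ≤ L) (q : RQubit L) :
    ind (cell a b \ rotatedTree L) q =
      ind (linkSupport L a b) q + ∑ t ∈ middleParents q, ind (linkSupport L a b) t := by
  by_cases hq : q.2.val = L / 2
  · have hm : point L (linkEnd L a) (L / 2) ∈ middleParents q ↔
        ((linkEnd L a + 1 = q.1.val ∧ q.1.val ≤ L / 2) ∨
          (q.1.val + 1 = linkEnd L a ∧ L / 2 ≤ q.1.val)) := by
      simp only [middleParents, Finset.mem_filter, Finset.mem_univ, true_and, point, linkEnd]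
      split_ifs <;> omega
    have hsum : ∑ t ∈ middleParents q, ind (linkSupport L a b) t =
        if (b = L / 2 ∨ b = L / 2 + 1) ∧ point L (linkEnd L a) (L / 2) ∈ middleParents q
          then 1 else 0 := by
      have h1 : ∀ t ∈ middleParents q, ind (linkSupport L a b) t =
          if t = point L (linkEnd L a) (L / 2) then
            if b = L / 2 ∨ b = L / 2 + 1 then 1 else 0 else 0 := by
        intro t ht
        have ht := (Finset.mem_filter.1 ht).2.1
        rw [← ite_and]
        simp only [ind, linkSupport, Finset.mem_filter, Finset.mem_univ, true_and, point_eq_iff]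
        refine if_congr ?_ rfl rfl
        rw [min_eq_left (linkEnd_le ha'), min_eq_left (show L / 2 ≤ L by omega)]
        tauto
      rw [Finset.sum_congr rfl h1, Finset.sum_ite_eq', ← ite_and]
      simp only [and_comm]
    simp only [hsum, hm]
    have hx := q.1.isLt
    have he := linkEnd_cases L a
    simp only [ind, Finset.mem_sdiff, mem_cell, mem_rotatedTree, IsTreePoint, linkSupport,
      Finset.mem_filter, Finset.mem_univ, true_and, hq]
    generalize linkEnd L a = e at he ⊢
    by_cases hb : b = L / 2 ∨ b = L / 2 + 1
    · simp only [hb, true_and, lt_irrefl, false_and, or_false, not_false_eq_true, and_true, ne_eq,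
        not_true_eq_false, false_or]
      split_ifs <;> first | decide | omega
    · rw [if_neg (by omega), if_neg (by omega), if_neg (by tauto), add_zero]
  · rw [Finset.sum_eq_zero, add_zero]
    · simp [ind, linkSupport, hq]
    · intro t ht
      exact absurd (Finset.mem_filter.1 ht).2.2.1 hq

/-- The second circuit changes only the `Z` cells next to the middle row: it replaces their two
qubits in the middle row by one. -/
theorem exists_middle_circuit (L : ℕ) :
    ∃ W : List (List (RQubit L × RQubit L)),
      IsCircuit (fun c t => rotatedNear c t ∧ c ∈ (rotatedTree L)ᶜ ∧ t ∈ (rotatedTree L)ᶜ) W ∧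
      W.length = L - L / 2 ∧
      conj W (-∑ u ∈ zCells L, pauliZ (cell u.1 u.2 \ rotatedTree L)) =
        -∑ u ∈ zCells L, pauliZ (linkSupport L u.1 u.2) := by
  have hr : ∀ q : RQubit L, ∀ t ∈ middleParents q, middleRank t < middleRank q := middleRank_lt
  refine ⟨reverseGates (rankCircuit middleParents middleRank (L - L / 2)),
    IsCircuit.reverseGates (isCircuit_rankCircuit hr ?_ _), by simp [reverseGates, rankCircuit], ?_⟩
  · intro q t ht
    have ht := (Finset.mem_filter.1 ht).2
    rw [rotatedNear, Finset.mem_compl, Finset.mem_compl, mem_rotatedTree, mem_rotatedTree,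
      IsTreePoint, IsTreePoint]
    omega
  · rw [conj_neg, conj_sum]
    congr 1
    refine Finset.sum_congr rfl fun u hu => ?_
    rw [mem_zCells] at hu
    exact conj_reverseGates_pauliZ hr middleRank_le (ind_cell_sdiff hu.1.1 hu.1.2)

/-- The column `a` of the `Z` cell `(a, b)` that meets the column `2 * j + 1` of qubits. -/
def chainCell (j b : ℕ) : ℕ := 2 * j + 1 + b % 2

/-- The chain that starts in the middle row and goes down the column `2 * j + 1`. -/
def lowerChain (L j i : ℕ) : RQubit L :=
  if i = 0 then point L (linkEnd L (chainCell j (L / 2))) (L / 2)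
  else point L (2 * j + 1) (L / 2 - i)

/-- The chain that starts in the middle row and goes up the column `2 * j + 1`. -/
def upperChain (L j i : ℕ) : RQubit L :=
  if i = 0 then point L (linkEnd L (chainCell j (L / 2 + 1))) (L / 2)
  else point L (2 * j + 1) (L / 2 + i)

/-- For odd `L`, the only qubit that both circuits leave of the `Z` cell `(L, b)`, where `b`
is even. -/
def sidePoint (L b : ℕ) : RQubit L :=
  if b < L / 2 then point L L b
  else if b ≤ L / 2 + 1 then point L (linkEnd L L) (L / 2)
  else point L L (b - 1)

lemma mem_linkSupport {a b : ℕ} {q : RQubit L} :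
    q ∈ linkSupport L a b ↔
    (q.2.val ≠ L / 2 ∧ ((q.1.val = a ∨ q.1.val + 1 = a) ∧ (q.2.val = b ∨ q.2.val + 1 = b)) ∧
      ¬ IsTreePoint L q.1.val q.2.val) ∨
      (q.2.val = L / 2 ∧ (b = L / 2 ∨ b = L / 2 + 1) ∧ q.1.val = linkEnd L a) := by
  simp only [linkSupport, Finset.mem_filter, Finset.mem_univ, true_and, Finset.mem_sdiff, mem_cell,
    mem_rotatedTree]

lemma linkSupport_lower {j i : ℕ} (hj : j < L / 2) (hi : i < L / 2) :
    linkSupport L (chainCell j (L / 2 - i)) (L / 2 - i) =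
      {lowerChain L j i, lowerChain L j (i + 1)} := by
  ext q
  have h0 : linkEnd L (chainCell j (L / 2)) ≤ L := linkEnd_le (by rw [chainCell]; omega)
  have h1 := q.1.isLt
  have h2 := q.2.isLt
  simp only [Finset.mem_insert, Finset.mem_singleton, mem_linkSupport, IsTreePoint, lowerChain,
    if_neg (Nat.succ_ne_zero i), point_eq_iff]
  by_cases h : i = 0
  · subst h
    simp only [if_true, point_eq_iff, Nat.sub_zero, min_eq_left h0,
      min_eq_left (show L / 2 ≤ L by omega)]
    generalize linkEnd L (chainCell j (L / 2)) = e at h0 ⊢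
    simp only [chainCell, true_or, true_and]
    omega
  · simp only [h, if_false, point_eq_iff]
    simp only [chainCell]
    omega

lemma linkSupport_lower_last {j : ℕ} (hj : j < L / 2) :
    linkSupport L (chainCell j 0) 0 = {lowerChain L j (L / 2)} := by
  ext q
  have h0 : linkEnd L (chainCell j (L / 2)) ≤ L := linkEnd_le (by rw [chainCell]; omega)
  have h1 := q.1.isLt
  have h2 := q.2.isLt
  simp only [Finset.mem_singleton, mem_linkSupport, IsTreePoint, lowerChain,
    if_neg (show L / 2 ≠ 0 by omega), point_eq_iff]
  simp only [chainCell]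
  omega

lemma linkSupport_upper {j i : ℕ} (hj : j < L / 2) (hi : i < L - L / 2) :
    linkSupport L (chainCell j (L / 2 + 1 + i)) (L / 2 + 1 + i) =
      {upperChain L j i, upperChain L j (i + 1)} := by
  ext q
  have h0 : linkEnd L (chainCell j (L / 2 + 1)) ≤ L := linkEnd_le (by rw [chainCell]; omega)
  have h1 := q.1.isLt
  have h2 := q.2.isLt
  simp only [Finset.mem_insert, Finset.mem_singleton, mem_linkSupport, IsTreePoint, upperChain,
    if_neg (Nat.succ_ne_zero i), point_eq_iff]
  by_cases h : i = 0
  · subst h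
    simp only [if_true, point_eq_iff, Nat.add_zero, min_eq_left h0,
      min_eq_left (show L / 2 ≤ L by omega)]
    generalize linkEnd L (chainCell j (L / 2 + 1)) = e at h0 ⊢
    simp only [chainCell, or_true, true_and]
    omega
  · simp only [h, if_false, point_eq_iff]
    simp only [chainCell]
    omega

lemma linkSupport_upper_last {j : ℕ} (hj : j < L / 2) :
    linkSupport L (chainCell j (L + 1)) (L + 1) = {upperChain L j (L - L / 2)} := by
  ext q
  have h0 : linkEnd L (chainCell j (L / 2 + 1)) ≤ L := linkEnd_le (by rw [chainCell]; omega)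
  have h1 := q.1.isLt
  have h2 := q.2.isLt
  simp only [Finset.mem_singleton, mem_linkSupport, IsTreePoint, upperChain,
    if_neg (show L - L / 2 ≠ 0 by omega), point_eq_iff]
  simp only [chainCell]
  omega

lemma linkSupport_side {b : ℕ} (hL : L % 2 = 1) (hb : b % 2 = 0) (hb' : b ≤ L + 1) :
    linkSupport L L b = {sidePoint L b} := by
  ext q
  have h1 := q.1.isLt
  have h2 := q.2.isLt
  simp only [Finset.mem_singleton, mem_linkSupport, IsTreePoint, sidePoint, linkEnd]
  split_ifs <;> rw [point_eq_iff] <;> omega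

end RotatedChains

/-! ### Sums over chains and cells -/

section ChainSums

lemma sum_map_range {M : Type*} [AddCommMonoid M] (f : ℕ → M) (n : ℕ) :
    ((List.range n).map f).sum = ∑ i ∈ Finset.range n, f i := by
  induction n with
  | zero => simp
  | succ n ih => rw [List.range_succ, List.map_append, List.sum_append, ih,
      Finset.sum_range_succ]; simp

lemma isingChain_map_range {Q : Type} [DecidableEq Q] (P : Finset Q → Op Q) (c : ℕ → Q) (n : ℕ) :
    isingChain P ((List.range (n + 1)).map c) =
      -(∑ i ∈ Finset.range n, P {c i, c (i + 1)} + P {c n}) := by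
  induction n generalizing c with
  | zero => simp [isingChain]
  | succ n ih =>
    have h := ih fun i => c (i + 1)
    have e : (List.range (n + 1)).map (fun i => c (i + 1)) =
        c 1 :: (List.range n).map fun i => c (i + 2) := by
      rw [List.range_succ_eq_map, List.map_cons, List.map_map]; rfl
    rw [List.range_succ_eq_map, List.map_cons, List.map_map]
    rw [show (c ∘ Nat.succ) = fun i => c (i + 1) from rfl, e, isingChain, ← e, h,
      Finset.sum_range_succ']
    abel

lemma sum_Icc_two_mul {M : Type*} [AddCommMonoid M] (f : ℕ → M) (n : ℕ) :
    ∑ a ∈ Finset.Icc 1 (2 * n), f a =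
      ∑ j ∈ Finset.range n, (f (2 * j + 1) + f (2 * j + 2)) := by
  induction n with
  | zero => simp
  | succ n ih =>
    rw [show 2 * (n + 1) = 2 * n + 1 + 1 by ring, Finset.sum_Icc_succ_top (by omega),
      Finset.sum_Icc_succ_top (by omega), ih, Finset.sum_range_succ, add_assoc]

lemma sum_range_even {M : Type*} [AddCommMonoid M] (g : ℕ → M) (n : ℕ) :
    ∑ b ∈ Finset.range (2 * n + 1), (if Even b then g b else 0) =
      ∑ m ∈ Finset.range (n + 1), g (2 * m) := by
  induction n with
  | zero => simp
  | succ n ih =>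
    rw [show 2 * (n + 1) + 1 = 2 * n + 1 + 1 + 1 by ring, Finset.sum_range_succ,
      Finset.sum_range_succ, ih, Finset.sum_range_succ _ (n + 1), if_neg (by simp [parity_simps]),
      if_pos (by simp [parity_simps]), add_zero]
    rfl

/-- The `Z` cells are grouped by the odd column of qubits that they meet. The last group, for odd
`L`, meets the last column. -/
lemma sum_zCells {M : Type*} [AddCommMonoid M] (L : ℕ) (t : ℕ → ℕ → M) :
    ∑ u ∈ zCells L, t u.1 u.2 =
      ∑ j ∈ Finset.range (L / 2), ∑ b ∈ Finset.range (L + 2), t (chainCell j b) b +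
        if Even L then 0 else ∑ m ∈ Finset.range (L / 2 + 2), t L (2 * m) := by
  rw [zCells, Finset.sum_filter, Finset.sum_product]
  dsimp only
  have h : ∑ a ∈ Finset.Icc 1 (2 * (L / 2)),
      ∑ b ∈ Finset.range (L + 2), (if Odd (a + b) then t a b else 0) =
      ∑ j ∈ Finset.range (L / 2), ∑ b ∈ Finset.range (L + 2), t (chainCell j b) b := by
    rw [sum_Icc_two_mul]
    refine Finset.sum_congr rfl fun j _ => ?_
    rw [← Finset.sum_add_distrib]
    refine Finset.sum_congr rfl fun b _ => ?_
    rw [chainCell]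
    rcases Nat.mod_two_eq_zero_or_one b with hb | hb
    · rw [if_pos (by rw [Nat.odd_iff]; omega), if_neg (by rw [Nat.odd_iff]; omega), hb, add_zero]
    · rw [if_neg (by rw [Nat.odd_iff]; omega), if_pos (by rw [Nat.odd_iff]; omega), hb, zero_add]
  split_ifs with hL
  · rw [add_zero, ← h, Nat.two_mul_div_two_of_even hL]
  · rw [Nat.not_even_iff_odd] at hL
    have e : 2 * (L / 2) + 1 = L := Nat.two_mul_div_two_add_one_of_odd hL
    rw [← h]
    nth_rw 1 [← e]
    rw [Finset.sum_Icc_succ_top (by omega), e]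
    congr 1
    rw [show L + 2 = 2 * (L / 2 + 1) + 1 by omega, ← sum_range_even]
    refine Finset.sum_congr rfl fun b _ => if_congr ?_ rfl rfl
    rw [Nat.odd_add, iff_true_left hL]

end ChainSums

/-! ### The chains of the rotated surface code -/

section RotatedTheorem

variable {L : ℕ}

/-- The `Z` cells that meet the column `2 * j + 1` form the lower and the upper chain. -/
lemma sum_chainCell (L : ℕ) {j : ℕ} (hj : j < L / 2) :
    -∑ b ∈ Finset.range (L + 2), pauliZ (linkSupport L (chainCell j b) b) =
      isingChain pauliZ ((List.range (L / 2 + 1)).map (lowerChain L j)) +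
        isingChain pauliZ ((List.range (L - L / 2 + 1)).map (upperChain L j)) := by
  have e : L + 2 = (L / 2 + 1) + (L - L / 2 + 1) := by omega
  rw [isingChain_map_range, isingChain_map_range, e, Finset.sum_range_add, ← neg_add]
  congr 2
  · rw [← Finset.sum_range_reflect, Finset.sum_range_succ]
    congr 1
    · refine Finset.sum_congr rfl fun i hi => ?_
      rw [show L / 2 + 1 - 1 - i = L / 2 - i by omega,
        linkSupport_lower hj (Finset.mem_range.1 hi)]
    · rw [show L / 2 + 1 - 1 - L / 2 = 0 by omega, linkSupport_lower_last hj]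
  · rw [Finset.sum_range_succ]
    congr 1
    · exact Finset.sum_congr rfl fun i hi => by rw [linkSupport_upper hj (Finset.mem_range.1 hi)]
    · rw [show L / 2 + 1 + (L - L / 2) = L + 1 by omega, linkSupport_upper_last hj]

/-- The Ising chains of the `Z` system: two for each odd column except the last one, and, if `L` is
odd, single qubits for the `Z` cells that meet the last column. -/
def rotatedChains (L : ℕ) : List (List (RQubit L)) :=
  (List.range (L / 2)).map (fun j => (List.range (L / 2 + 1)).map (lowerChain L j)) ++
    (List.range (L / 2)).map (fun j => (List.range (L - L / 2 + 1)).map (upperChain L j)) ++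
    if Even L then [] else (List.range (L / 2 + 2)).map fun m => [sidePoint L (2 * m)]

lemma sum_rotatedChains (L : ℕ) :
    -∑ u ∈ zCells L, pauliZ (linkSupport L u.1 u.2) =
      ((rotatedChains L).map (isingChain pauliZ)).sum := by
  rw [rotatedChains, List.map_append, List.map_append, List.sum_append, List.sum_append,
    List.map_map, List.map_map, sum_map_range, sum_map_range, ← Finset.sum_add_distrib,
    sum_zCells L fun a b => pauliZ (linkSupport L a b), neg_add, ← Finset.sum_neg_distrib]
  congr 1
  · exact Finset.sum_congr rfl fun j hj => sum_chainCell L (Finset.mem_range.1 hj)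
  · split_ifs with hL
    · simp
    · rw [List.map_map, sum_map_range, ← Finset.sum_neg_distrib]
      rw [Nat.not_even_iff] at hL
      refine Finset.sum_congr rfl fun m hm => ?_
      rw [Finset.mem_range] at hm
      rw [linkSupport_side hL (by omega) (by omega)]
      rfl

lemma mem_lowerChain {j : ℕ} (hj : j < L / 2) {q : RQubit L}
    (hq : q ∈ (List.range (L / 2 + 1)).map (lowerChain L j)) :
    (q.2.val < L / 2 ∧ q.1.val = 2 * j + 1) ∨
      (q.2.val = L / 2 ∧ q.1.val = linkEnd L (chainCell j (L / 2))) := by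
  obtain ⟨i, hi, rfl⟩ := List.mem_map.1 hq
  rw [List.mem_range] at hi
  have h0 : linkEnd L (chainCell j (L / 2)) ≤ L := linkEnd_le (by rw [chainCell]; omega)
  rw [lowerChain]
  split_ifs with h
  · right; simp only [point]; omega
  · left; simp only [point]; omega

lemma mem_upperChain {j : ℕ} (hj : j < L / 2) {q : RQubit L}
    (hq : q ∈ (List.range (L - L / 2 + 1)).map (upperChain L j)) :
    (L / 2 < q.2.val ∧ q.1.val = 2 * j + 1) ∨
      (q.2.val = L / 2 ∧ q.1.val = linkEnd L (chainCell j (L / 2 + 1))) := by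
  obtain ⟨i, hi, rfl⟩ := List.mem_map.1 hq
  rw [List.mem_range] at hi
  have h0 : linkEnd L (chainCell j (L / 2 + 1)) ≤ L := linkEnd_le (by rw [chainCell]; omega)
  rw [upperChain]
  split_ifs with h
  · right; simp only [point]; omega
  · left; simp only [point]; omega

lemma sidePoint_spec {m : ℕ} (hm : m < L / 2 + 2) (hL : L % 2 = 1) :
    ((sidePoint L (2 * m)).2.val = L / 2 ∧ (sidePoint L (2 * m)).1.val = linkEnd L L ∧
        (2 * m = L / 2 ∨ 2 * m = L / 2 + 1)) ∨
      ((sidePoint L (2 * m)).1.val = L ∧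
        (((sidePoint L (2 * m)).2.val < L / 2 ∧ (sidePoint L (2 * m)).2.val = 2 * m) ∨
          (L / 2 < (sidePoint L (2 * m)).2.val ∧ (sidePoint L (2 * m)).2.val + 1 = 2 * m))) := by
  have := linkEnd_le (le_refl L)
  rw [sidePoint]
  split_ifs <;> simp only [point] <;> omega

lemma lowerChain_nodup {j : ℕ} : ((List.range (L / 2 + 1)).map (lowerChain L j)).Nodup := by
  refine List.Nodup.map_on (fun a ha b hb h => ?_) List.nodup_range
  rw [List.mem_range] at ha hb
  have := congrArg (fun q => q.2.val) h
  simp only [lowerChain, apply_ite (fun q : RQubit L => q.2.val), point] at this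
  split_ifs at this <;> omega

lemma upperChain_nodup {j : ℕ} : ((List.range (L - L / 2 + 1)).map (upperChain L j)).Nodup := by
  refine List.Nodup.map_on (fun a ha b hb h => ?_) List.nodup_range
  rw [List.mem_range] at ha hb
  have := congrArg (fun q => q.2.val) h
  simp only [upperChain, apply_ite (fun q : RQubit L => q.2.val), point] at this
  split_ifs at this <;> omega

lemma mem_rotatedChains {l : List (RQubit L)} : l ∈ rotatedChains L ↔
    (∃ j < L / 2, (List.range (L / 2 + 1)).map (lowerChain L j) = l) ∨
    (∃ j < L / 2, (List.range (L - L / 2 + 1)).map (upperChain L j) = l) ∨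
    (L % 2 = 1 ∧ ∃ m < L / 2 + 2, [sidePoint L (2 * m)] = l) := by
  rw [rotatedChains]
  split_ifs with hL
  · rw [Nat.even_iff] at hL
    simp [hL]
  · rw [Nat.not_even_iff] at hL
    simp [hL]

lemma rotatedChains_nodup (L : ℕ) : (rotatedChains L).flatten.Nodup := by
  rw [List.nodup_flatten]
  constructor
  · intro l hl
    rcases mem_rotatedChains.1 hl with ⟨j, -, rfl⟩ | ⟨j, -, rfl⟩ | ⟨-, m, -, rfl⟩
    · exact lowerChain_nodup
    · exact upperChain_nodup
    · exact List.nodup_singleton _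
  · have hc : ∀ j j', chainCell j (L / 2) ≠ chainCell j' (L / 2 + 1) := by
      intro j j'
      simp only [chainCell]
      omega
    rw [rotatedChains, List.pairwise_append, List.pairwise_append]
    refine ⟨⟨?_, ?_, ?_⟩, ?_, ?_⟩
    · rw [List.pairwise_map]
      refine List.Pairwise.imp_of_mem (fun {i j} hi hj hij => ?_) List.pairwise_lt_range
      rw [List.mem_range] at hi hj
      intro q h1 h2
      have h1 := mem_lowerChain hi h1
      have h2 := mem_lowerChain hj h2
      have h3 := linkEnd_cases L (chainCell i (L / 2))
      have h4 := linkEnd_cases L (chainCell j (L / 2))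
      simp only [chainCell] at *
      omega
    · rw [List.pairwise_map]
      refine List.Pairwise.imp_of_mem (fun {i j} hi hj hij => ?_) List.pairwise_lt_range
      rw [List.mem_range] at hi hj
      intro q h1 h2
      have h1 := mem_upperChain hi h1
      have h2 := mem_upperChain hj h2
      have h3 := linkEnd_cases L (chainCell i (L / 2 + 1))
      have h4 := linkEnd_cases L (chainCell j (L / 2 + 1))
      simp only [chainCell] at *
      omega
    · intro l hl l' hl' q h1 h2
      obtain ⟨i, hi, rfl⟩ := List.mem_map.1 hl
      obtain ⟨j, hj, rfl⟩ := List.mem_map.1 hl'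
      have h1 := mem_lowerChain (List.mem_range.1 hi) h1
      have h2 := mem_upperChain (List.mem_range.1 hj) h2
      have h3 := linkEnd_cases L (chainCell i (L / 2))
      have h4 := linkEnd_cases L (chainCell j (L / 2 + 1))
      simp only [chainCell] at *
      omega
    · split_ifs with hL
      · exact List.Pairwise.nil
      · rw [Nat.not_even_iff] at hL
        rw [List.pairwise_map]
        refine List.Pairwise.imp_of_mem (fun {i j} hi hj hij => ?_) List.pairwise_lt_range
        rw [List.mem_range] at hi hj
        intro q h1 h2
        rw [List.mem_singleton] at h1 h2
        have h3 := sidePoint_spec hi hL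
        have h4 := sidePoint_spec hj hL
        rw [← h1] at h3
        rw [← h2] at h4
        omega
    · intro l hl l' hl' q h1 h2
      split_ifs at hl' with hL
      · simp at hl'
      · rw [Nat.not_even_iff] at hL
        obtain ⟨m, hm, rfl⟩ := List.mem_map.1 hl'
        rw [List.mem_singleton] at h2
        have h3 := sidePoint_spec (List.mem_range.1 hm) hL
        rw [← h2] at h3
        have h4 := linkEnd_cases L L
        rcases List.mem_append.1 hl with hl | hl
        · obtain ⟨i, hi, rfl⟩ := List.mem_map.1 hl
          have hi := List.mem_range.1 hi
          have h1 := mem_lowerChain hi h1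
          have h5 := linkEnd_cases L (chainCell i (L / 2))
          simp only [chainCell] at *
          omega
        · obtain ⟨i, hi, rfl⟩ := List.mem_map.1 hl
          have hi := List.mem_range.1 hi
          have h1 := mem_upperChain hi h1
          have h5 := linkEnd_cases L (chainCell i (L / 2 + 1))
          simp only [chainCell] at *
          omega

lemma notMem_rotatedTree_of_mem {q : RQubit L} (hq : q ∈ (rotatedChains L).flatten) :
    q ∉ rotatedTree L := by
  rw [mem_rotatedTree, IsTreePoint]
  obtain ⟨l, hl, hql⟩ := List.mem_flatten.1 hq
  rcases mem_rotatedChains.1 hl with ⟨j, hj, rfl⟩ | ⟨j, hj, rfl⟩ | ⟨hL, m, hm, rfl⟩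
  · have := mem_lowerChain hj hql
    omega
  · have := mem_upperChain hj hql
    omega
  · rw [List.mem_singleton] at hql
    have := sidePoint_spec hm hL
    rw [← hql] at this
    omega

end RotatedTheorem

end CSSIsing

open CSSIsing in
theorem theorem1 :
    -- toric code
    (∀ (L : ℕ) [NeZero L], 2 ≤ L →
      ∃ (U : List (List (TQubit L × TQubit L))) (qx qz : Finset (TQubit L)) (HX HZ : Op (TQubit L)),
        -- the local circuit of depth at most `L` and the two decoupled systems
        IsCircuit toricNear U ∧ U.length ≤ L ∧ Disjoint qx qz ∧
        conj U (toricH L) = HX + HZ ∧ IsPure pauliX qx HX ∧ IsPure pauliZ qz HZ ∧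
        HX = parityCheck pauliX qx ∧
        -- both systems are Ising loops on `L ^ 2` qubits, up to further gates of each system
        ∃ a b : Fin (L ^ 2) → TQubit L,
          Function.Injective a ∧ Function.Injective b ∧ (∀ i j, a i ≠ b j) ∧
          (∀ q ∈ qx, q ∈ Set.range a) ∧ (∀ j, b j ∈ qz) ∧
          (∃ VX : List (List (TQubit L × TQubit L)),
            IsCircuit (fun c t => c ∈ Set.range a ∧ t ∈ Set.range a) VX ∧
            conj VX HX = isingLoop pauliX a) ∧
          (∃ VZ : List (TQubit L × TQubit L),
            IsLayer (fun c t => c ∈ qz ∧ t ∈ qz) VZ ∧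
            conj [VZ] HZ = isingLoop pauliZ b)) ∧
    -- rotated surface code
    (∀ L : ℕ, 1 ≤ L →
      ∃ (U : List (List (RQubit L × RQubit L))) (qx qz : Finset (RQubit L)) (HX HZ : Op (RQubit L)),
        -- the local circuit of depth about `L / 2` and the two decoupled systems
        IsCircuit rotatedNear U ∧ U.length ≤ (if Even L then L / 2 else (L - 1) / 2 + 2) ∧
        Disjoint qx qz ∧
        conj U (rotatedH L) = HX + HZ ∧ IsPure pauliX qx HX ∧ IsPure pauliZ qz HZ ∧
        HX = field pauliX qx ∧
        -- further local gates of the second system turn it into open Ising chains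
        ∃ (W : List (List (RQubit L × RQubit L))) (chains : List (List (RQubit L))),
          IsCircuit (fun c t => rotatedNear c t ∧ c ∈ qz ∧ t ∈ qz) W ∧
          W.length ≤ (L + 1) / 2 ∧
          chains.flatten.Nodup ∧ (∀ l ∈ chains, l ≠ []) ∧ (∀ q ∈ chains.flatten, q ∈ qz) ∧
          chains.length ≤ 2 * L ∧
          (Even L → chains.length = L ∧ ∀ l ∈ chains, l.length = L / 2 + 1) ∧
          conj W HZ = (chains.map (isingChain pauliZ)).sum) := by
  refine ⟨fun L _ hL => ?_, fun L hL => ?_⟩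
  · obtain ⟨U, hU, hlen, hconj⟩ := exists_toric_decoupling hL
    obtain ⟨VX, hVX, hVX'⟩ := exists_parityCheck_loop_circuit
      (hL.trans (Nat.le_self_pow two_ne_zero L)) (treeLoopQubit_injective hL)
    rw [← toricTree_eq_image] at hVX'
    obtain ⟨VZ, hVZ, hVZ'⟩ := exists_plaquette_loop_layer hL
    refine ⟨U, toricTree L, (toricTree L)ᶜ, _, _, hU, hlen, disjoint_compl_right, hconj,
      isPure_parityCheck _ _, isPure_neg_sum _ _ fun u _ => ?_, rfl, treeLoopQubit,
      fun i => loopQubit (vertexAt L i), treeLoopQubit_injective hL,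
      loopQubit_injective.comp vertexAt_bijective.1,
      fun i j => loopQubit_ne_treeLoopQubit hL i _, fun q hq => ?_,
      fun j => Finset.mem_compl.2 (loopQubit_notMem_toricTree hL _), ⟨VX, hVX, hVX'⟩, VZ, hVZ, hVZ'⟩
    · exact fun q hq => Finset.mem_compl.2 (Finset.mem_sdiff.1 hq).2
    · rw [toricTree_eq_image] at hq
      obtain ⟨i, -, rfl⟩ := Finset.mem_image.1 hq
      exact ⟨i, rfl⟩
  · obtain ⟨U, hU, hlen, hconj⟩ := exists_rotated_decoupling L
    obtain ⟨W, hW, hWlen, hWconj⟩ := exists_middle_circuit L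
    refine ⟨U, rotatedTree L, (rotatedTree L)ᶜ, _, _, hU, ?_, disjoint_compl_right, hconj,
      isPure_field _ _, isPure_neg_sum _ _ fun u _ => ?_, rfl, W, rotatedChains L, hW, by omega,
      rotatedChains_nodup L, ?_, fun q hq => Finset.mem_compl.2 (notMem_rotatedTree_of_mem hq),
      ?_, ?_, hWconj.trans (sum_rotatedChains L)⟩
    · split_ifs with h
      · rw [Nat.even_iff] at h
        omega
      · rw [Nat.not_even_iff] at h
        omega
    · exact fun q hq => Finset.mem_compl.2 (Finset.mem_sdiff.1 hq).2
    · intro l hl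
      rcases mem_rotatedChains.1 hl with ⟨j, -, rfl⟩ | ⟨j, -, rfl⟩ | ⟨-, m, -, rfl⟩ <;> simp
    · rw [rotatedChains]
      split_ifs with h
      · simp
        omega
      · rw [Nat.not_even_iff] at h
        simp
        omega
    · intro h
      have h' := Nat.even_iff.1 h
      refine ⟨?_, fun l hl => ?_⟩
      · rw [rotatedChains, if_pos h]
        simp
        omega
      · rcases mem_rotatedChains.1 hl with ⟨j, -, rfl⟩ | ⟨j, -, rfl⟩ | ⟨h1, -⟩
        · simp
        · simp
          omega
        · omega
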